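/- Let $k,m\in\mathbb N$, let $U\subset\mathbb R^m$ be nonempty and compact, and let $W=(W_t)_{t\in\mathbb N}$ be i.i.d. $\mathbb R^{k+m}$-valued random vectors on a probability space $(\Omega,\mathcal F,\mathbb P)$. Put $\mathcal F_t=\sigma(W_0,\dots,W_{t-1})$ (so $\mathcal F_0$ is trivial), and let $\mathcal A$ be the set of all $U$-valued $(\mathcal F_t)$-adapted processes $H=(H_t)_{t\in\mathbb N}$. Let $G:\mathbb R^k\times\mathbb R^{k+m}\to\mathbb R^k$ be Borel measurable with $x\mapsto G(x,w)$ continuous for every $w$, and let $F:\mathbb R^k\times U\times\mathbb R^{k+m}\to\mathbb R$ be Borel measurable with $(x,h)\mapsto F(x,h,w)$ continuous for every $w$. For $X_0\in\mathbb R^k$, $V_0>0$ and $H\in\mathcal A$ define $$X_{t+1}=G(X_t,W_t),\qquad V^H_0=V_0,\qquad \ln\frac{V^H_{t+1}}{V^H_t}=F(X_t,H_t,W_t).$$ For a real random variable $Z$ let $\mu^\gamma(Z)=\frac1\gamma\ln\mathbb E[e^{\gamma Z}]$ if $\gamma\ne0$ and $\mu^0(Z)=\mathbb E[Z]$, and for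 $\gamma<0$ let $$\varphi^\gamma(V)=\liminf_{t\to\infty}\frac1t\,\frac1\gamma\ln\mathbb E[V_t^\gamma].$$ Assume that there are a continuous $\omega:\mathbb R^k\to[0,\infty)$, Borel functions $a_1,a_2:\mathbb R^{k+m}\to[0,\infty)$ and constants $b_1\in(0,1)$, $b_2>0$ such that, for all $x,h,w$, $$\omega(G(x,w))\le a_1(w)+b_1\omega(x),\qquad |F(x,h,w)|\le a_2(w)+b_2\omega(x),$$ and $\mu^\gamma(a_1(W_0)),\mu^\gamma(a_2(W_0))\in\mathbb R$ for every $\gamma\in\mathbb R$. Assume also that for every $R>0$ there are $c>0$ and a probability measure $\nu$ on $\mathbb R^k$ such that $\mathbb P[G(x,W_0)\in A]\ge c\,\nu(A)$ for all Borel $A\subset\mathbb R^k$ and all $x$ with $\omega(x)\le R$. Let $\mathcal C_\omega(\mathbb R^k)$ be the set of continuous $f:\mathbb R^k\to\mathbb R$ with $\sup_x |f(x)|/(1+\omega(x))<\infty$. Then there is $\gamma_0<0$, not depending on $X_0$ and $V_0$, such that for every $\gamma\in(\gamma_0,0)$ the Bellman equation $$v(x)+\lambda=\sup_{h\in U}\mu^\gamma\big(F(x,h,W_0)+v(G(x,W_0))\big),\qquad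 x\in\mathbb R^k,$$ has a solution $(v_\gamma,\lambda_\gamma)\in\mathcal C_\omega(\mathbb R^k)\times\mathbb R$, with $\lambda_\gamma$ unique and $v_\gamma$ unique up to an additive constant, and, for all $X_0\in\mathbb R^k$ and $V_0>0$, $$\lambda_\gamma\ \ge\ \sup_{H\in\mathcal A}\varphi^\gamma(V^H).$$ If, moreover, $a_1$ is bounded from above, then, for all $X_0\in\mathbb R^k$ and $V_0>0$, $\lambda_\gamma=\sup_{H\in\mathcal A}\varphi^\gamma(V^H)$, and optimal strategies are given by selectors of the Bellman equation: there is a Borel map $\eta:\mathbb R^k\to U$ such that, for every $x\in\mathbb R^k$, $h=\eta(x)$ attains the supremum in the Bellman equation with $v=v_\gamma$; and for every such $\eta$ the strategy $\hat H_t=\eta(X_t)$ belongs to $\mathcal A$ and satisfies $\varphi^\gamma(V^{\hat H})=\lambda_\gamma$ for all $X_0\in\mathbb R^k$ and $V_0>0$. -/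

import Mathlib

open MeasureTheory ProbabilityTheory Filter

namespace RSC

/-- `n`-dimensional real space. -/
abbrev Vec (n : ℕ) : Type := EuclideanSpace ℝ (Fin n)

noncomputable section

variable {Ω : Type*}

/-- The entropic utility `μ^γ(Z)`, an extended real number: `(1/γ) ln E[exp (γ Z)]` if `γ ≠ 0`, and
`E[Z] = E[Z⁺] - E[Z⁻]` if `γ = 0`. The expectations are taken in `[0, ∞]`. -/
def entropicUtility [MeasurableSpace Ω] (P : Measure Ω) (γ : ℝ) (Z : Ω → ℝ) : EReal :=
  if γ = 0 then
    ((∫⁻ o, ENNReal.ofReal (Z o) ∂P : ENNReal) : EReal) -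
      ((∫⁻ o, ENNReal.ofReal (-Z o) ∂P : ENNReal) : EReal)
  else
    ((1 / γ : ℝ) : EReal) * ENNReal.log (∫⁻ o, ENNReal.ofReal (Real.exp (γ * Z o)) ∂P)

/-- The risk sensitive criterion `φ^γ(V) = liminf_{t → ∞} (1/t) (1/γ) ln E[V_t ^ γ]` of a positive
process `V`, as an extended real number. -/
def riskSensitiveCriterion [MeasurableSpace Ω] (P : Measure Ω) (γ : ℝ) (V : ℕ → Ω → ℝ) : EReal :=
  liminf (fun t : ℕ => ((1 / (t : ℝ) : ℝ) : EReal) *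
    (((1 / γ : ℝ) : EReal) * ENNReal.log (∫⁻ o, ENNReal.ofReal (V t o ^ γ) ∂P))) atTop

/-- The `σ`-algebra `𝓕_t` generated by `W_0, …, W_{t-1}`; in particular `𝓕_0` is trivial. -/
abbrev noiseSigma {n : ℕ} (W : ℕ → Ω → Vec n) (t : ℕ) : MeasurableSpace Ω :=
  ⨆ s : ℕ, ⨆ _ : s < t, MeasurableSpace.comap (W s) inferInstance

/-- (A.1) The noise `W_0, W_1, …` is a sequence of i.i.d. random vectors. -/
structure IsIIDNoise {n : ℕ} [MeasurableSpace Ω] (P : Measure Ω) (W : ℕ → Ω → Vec n) : Prop where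
  measurable : ∀ t, Measurable (W t)
  indep : iIndepFun W P
  identDistrib : ∀ t, IdentDistrib (W t) (W 0) P P

/-- The factor process: `X_0 = x₀`, `X_{t+1} = G (X_t, W_t)`. -/
def factor {k n : ℕ} (G : Vec k → Vec n → Vec k) (W : ℕ → Ω → Vec n) (x₀ : Vec k) :
    ℕ → Ω → Vec k
  | 0 => fun _ => x₀
  | t + 1 => fun o => G (factor G W x₀ t o) (W t o)

/-- (A.2) `G` is Borel measurable, and continuous in its first variable. -/
structure IsFactorMap {k n : ℕ} (G : Vec k → Vec n → Vec k) : Prop where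
  measurable : Measurable fun p : Vec k × Vec n => G p.1 p.2
  continuous : ∀ w, Continuous fun x => G x w

/-- (A.3) `F` is Borel measurable, and continuous in its first two variables (jointly). -/
structure IsLogReturnMap {k m n : ℕ} {U : Set (Vec m)} (F : Vec k → U → Vec n → ℝ) : Prop where
  measurable : Measurable fun p : Vec k × U × Vec n => F p.1 p.2.1 p.2.2
  continuous : ∀ w, Continuous fun p : Vec k × U => F p.1 p.2 w

/-- A strategy is a `U`-valued process `H`; it is admissible if it is adapted to the filtration
generated by the noise. -/
def IsAdmissible {m n : ℕ} {U : Set (Vec m)} (W : ℕ → Ω → Vec n) (H : ℕ → Ω → U) : Prop :=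
  ∀ t, Measurable[noiseSigma W t] (H t)

/-- The portfolio value process of the strategy `H`: `V_0 = V₀` and
`ln (V_{t+1} / V_t) = F (X_t, H_t, W_t)`, where `X` is the factor process started at `x₀`. -/
def portfolioValue {k m n : ℕ} {U : Set (Vec m)} (G : Vec k → Vec n → Vec k)
    (F : Vec k → U → Vec n → ℝ) (W : ℕ → Ω → Vec n) (x₀ : Vec k) (V₀ : ℝ) (H : ℕ → Ω → U) :
    ℕ → Ω → ℝ
  | 0 => fun _ => V₀
  | t + 1 => fun o =>
      portfolioValue G F W x₀ V₀ H t o * Real.exp (F (factor G W x₀ t o) (H t o) (W t o))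

/-- The optimal value `sup_H φ^γ(V^H)` over all admissible strategies `H`. -/
def optimalValue {k m n : ℕ} {U : Set (Vec m)} [MeasurableSpace Ω] (P : Measure Ω) (G : Vec k → Vec n → Vec k)
    (F : Vec k → U → Vec n → ℝ) (W : ℕ → Ω → Vec n) (γ : ℝ) (x₀ : Vec k) (V₀ : ℝ) : EReal :=
  ⨆ H : {H : ℕ → Ω → U // IsAdmissible W H},
    riskSensitiveCriterion P γ (portfolioValue G F W x₀ V₀ H.1)

/-- (A.4) The growth conditions with respect to the weight function `ω`, and finiteness of the
entropic utilities of `a₁ (W_0)` and `a₂ (W_0)`. -/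
structure HasWeightedGrowth {k m n : ℕ} {U : Set (Vec m)} [MeasurableSpace Ω] (P : Measure Ω) (W : ℕ → Ω → Vec n)
    (G : Vec k → Vec n → Vec k) (F : Vec k → U → Vec n → ℝ) (ω : Vec k → ℝ)
    (a₁ a₂ : Vec n → ℝ) (b₁ b₂ : ℝ) : Prop where
  weight_continuous : Continuous ω
  weight_nonneg : ∀ x, 0 ≤ ω x
  a₁_measurable : Measurable a₁
  a₂_measurable : Measurable a₂
  a₁_nonneg : ∀ w, 0 ≤ a₁ w
  a₂_nonneg : ∀ w, 0 ≤ a₂ w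
  b₁_pos : 0 < b₁
  b₁_lt_one : b₁ < 1
  b₂_pos : 0 < b₂
  growth_G : ∀ x w, ω (G x w) ≤ a₁ w + b₁ * ω x
  growth_F : ∀ x h w, |F x h w| ≤ a₂ w + b₂ * ω x
  a₁_utility : ∀ γ : ℝ, ∃ r : ℝ, entropicUtility P γ (fun o => a₁ (W 0 o)) = (r : EReal)
  a₂_utility : ∀ γ : ℝ, ∃ r : ℝ, entropicUtility P γ (fun o => a₂ (W 0 o)) = (r : EReal)

/-- (A.5) Local minorization on the sublevel sets `C_R = {x | ω x ≤ R}`. -/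
def HasLocalMinorization {k n : ℕ} [MeasurableSpace Ω] (P : Measure Ω) (W : ℕ → Ω → Vec n)
    (G : Vec k → Vec n → Vec k) (ω : Vec k → ℝ) : Prop :=
  ∀ R : ℝ, 0 < R → ∃ c : ℝ, 0 < c ∧ ∃ ν : Measure (Vec k), IsProbabilityMeasure ν ∧
    ∀ x, ω x ≤ R → ∀ A : Set (Vec k), MeasurableSet A →
      ENNReal.ofReal c * ν A ≤ P {o | G x (W 0 o) ∈ A}

/-- The space `C_ω(ℝ^k)` of continuous functions with finite `ω`-norm
`sup_x |f x| / (1 + ω x)`. -/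
def MemWeighted {k : ℕ} (ω : Vec k → ℝ) (f : Vec k → ℝ) : Prop :=
  Continuous f ∧ BddAbove (Set.range fun x => |f x| / (1 + ω x))

/-- The quantity `μ^γ(F(x, h, W_0) + v(G(x, W_0)))` which is maximized over `h ∈ U` in the Bellman
equation. -/
def bellmanUtility {k m n : ℕ} {U : Set (Vec m)} [MeasurableSpace Ω] (P : Measure Ω) (G : Vec k → Vec n → Vec k)
    (F : Vec k → U → Vec n → ℝ) (W : ℕ → Ω → Vec n) (γ : ℝ) (v : Vec k → ℝ) (x : Vec k) (h : U) :
    EReal :=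
  entropicUtility P γ (fun o => F x h (W 0 o) + v (G x (W 0 o)))

/-- `v ∈ C_ω(ℝ^k)` and `lam ∈ ℝ` solve the Bellman equation
`v(x) + lam = sup_{h ∈ U} μ^γ(F(x, h, W_0) + v(G(x, W_0)))` for all `x`. -/
def IsBellmanSolution {k m n : ℕ} {U : Set (Vec m)} [MeasurableSpace Ω] (P : Measure Ω) (G : Vec k → Vec n → Vec k)
    (F : Vec k → U → Vec n → ℝ) (W : ℕ → Ω → Vec n) (ω : Vec k → ℝ) (γ : ℝ)
    (v : Vec k → ℝ) (lam : ℝ) : Prop :=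
  MemWeighted ω v ∧ ∀ x, ((v x + lam : ℝ) : EReal) = ⨆ h : U, bellmanUtility P G F W γ v x h

/-- A Borel selector of the Bellman equation: a Borel map `x ↦ η x ∈ U` that attains the supremum
on its right-hand side for every `x`. -/
def IsBellmanSelector {k m n : ℕ} {U : Set (Vec m)} [MeasurableSpace Ω] (P : Measure Ω) (G : Vec k → Vec n → Vec k)
    (F : Vec k → U → Vec n → ℝ) (W : ℕ → Ω → Vec n) (γ : ℝ)
    (v : Vec k → ℝ) (η : Vec k → U) : Prop :=
  Measurable η ∧ ∀ x, bellmanUtility P G F W γ v x (η x) = ⨆ h : U, bellmanUtility P G F W γ v x h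

end

end RSC

/-! For `γ < 0`, Gibbs' inequality `IsExpEnvelope.integral_tilted_sub_le` bounds the increments of
the utility in `f` by expectations under exponentially tilted noise laws. Differences of Bellman
iterates are therefore governed by tilted transition kernels. While `|γ|` is at most `D` and `|γ f|`
at most `D (1 + ω)`, these kernels satisfy, uniformly in state, action and `f`, a drift condition
(`IsModel.exists_drift`) and an overlap condition on sublevel sets of `ω`
(`IsModel.exists_overlap`). Harris' theorem in the style of Hairer and Mattingly then gives one
weight `β` and one factor `L < 1` with which the Bellman operator contracts the weighted oscillation
(`IsModel.exists_bellman_contraction`).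

The factor `L` depends on `D`, while the size of the iterates depends on `L`. Scaling breaks the
circle: fix `D = 1`, compute the radius of an invariant oscillation ball, and only then take `γ` so
small that `γ` times the iterates stays within `1 + ω`. The fixed point modulo constants is `v`, and
the constant is `lam`. Uniqueness needs no smallness, because there `D` may be chosen after the two
solutions.

For verification, integrating out one noise variable at a time turns the Bellman inequality into
`E[V_t ^ γ exp (γ v(X_t))] ≥ const * exp (γ lam t)`, with equality along selectors. Since `v` may be
unbounded, the factor `exp (γ v)` is split off by Hölder's inequality. The remaining moments grow at
a rate independent of the weight (`exists_lintegral_weight_le`), so their share vanishes as the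
Hölder exponent tends to one, which gives the upper bound. If `a₁` is bounded, `ω(X_t)` is bounded
and the factor is harmless in both directions, so selectors attain `lam`. A Borel selector is the
lexicographically least maximizer. -/

namespace RSC

/-! ### Exponential tilting and Gibbs' inequality. -/

section ExpDominated

variable {S : Type*} [MeasurableSpace S]

/-- A measurable envelope `s ≥ 1` all of whose exponential moments are finite. -/
structure IsExpEnvelope (ρ : Measure S) (s : S → ℝ) : Prop where
  measurable : Measurable s
  one_le : ∀ w, 1 ≤ s w
  integrable_exp : ∀ θ : ℝ, Integrable (fun w => Real.exp (θ * s w)) ρ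

/-- `Z` is measurable and dominated by a multiple of the envelope `s`. -/
def Dominated (s : S → ℝ) (Z : S → ℝ) : Prop :=
  Measurable Z ∧ ∃ C : ℝ, ∀ w, |Z w| ≤ C * s w

variable {ρ : Measure S} {s Z Z₁ Z₂ φ : S → ℝ}

lemma Dominated.add (h₁ : Dominated s Z₁) (h₂ : Dominated s Z₂) :
    Dominated s (fun w => Z₁ w + Z₂ w) := by
  obtain ⟨m₁, C₁, h₁⟩ := h₁
  obtain ⟨m₂, C₂, h₂⟩ := h₂
  refine ⟨m₁.add m₂, C₁ + C₂, fun w => (abs_add_le _ _).trans ?_⟩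
  linarith [h₁ w, h₂ w]

lemma Dominated.const_mul (h : Dominated s Z) (c : ℝ) : Dominated s (fun w => c * Z w) := by
  obtain ⟨m, C, h⟩ := h
  refine ⟨m.const_mul c, |c| * C, fun w => ?_⟩
  rw [abs_mul, mul_assoc]
  exact mul_le_mul_of_nonneg_left (h w) (abs_nonneg c)

lemma Dominated.sub (h₁ : Dominated s Z₁) (h₂ : Dominated s Z₂) :
    Dominated s (fun w => Z₁ w - Z₂ w) := by
  simpa [sub_eq_add_neg] using h₁.add (h₂.const_mul (-1))

lemma IsExpEnvelope.pos (hs : IsExpEnvelope ρ s) (w : S) : 0 < s w :=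
  zero_lt_one.trans_le (hs.one_le w)

lemma IsExpEnvelope.dominated_const (hs : IsExpEnvelope ρ s) (c : ℝ) :
    Dominated s (fun _ => c) :=
  ⟨measurable_const, |c|, fun w => le_mul_of_one_le_right (abs_nonneg c) (hs.one_le w)⟩

lemma IsExpEnvelope.dominated (hs : IsExpEnvelope ρ s) : Dominated s s :=
  ⟨hs.measurable, 1, fun w => by rw [one_mul, abs_of_pos (hs.pos w)]⟩

/-- One unit of exponent pays for the factor `φ`, because `s ≤ exp s`; this is why the moment of
order `C + 1` is used. -/
lemma IsExpEnvelope.integrable_exp_mul (hs : IsExpEnvelope ρ s) (hZ : Dominated s Z)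
    (hφ : Dominated s φ) : Integrable (fun w => Real.exp (Z w) * φ w) ρ := by
  obtain ⟨mZ, C, hZ⟩ := hZ
  obtain ⟨mφ, C', hφ⟩ := hφ
  refine ((hs.integrable_exp (C + 1)).const_mul |C'|).mono'
    (mZ.exp.mul mφ).aestronglyMeasurable (ae_of_all _ fun w => ?_)
  have h0 := hs.pos w
  have h1 : |φ w| ≤ |C'| * Real.exp (s w) :=
    (hφ w).trans (mul_le_mul (le_abs_self C') (by linarith [Real.add_one_le_exp (s w)]) h0.le
      (abs_nonneg _))
  have h2 : Real.exp (Z w) ≤ Real.exp (C * s w) :=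
    Real.exp_le_exp.mpr ((le_abs_self _).trans (hZ w))
  rw [Real.norm_eq_abs, abs_mul, abs_of_pos (Real.exp_pos _), add_mul, one_mul, Real.exp_add]
  calc _ ≤ Real.exp (C * s w) * (|C'| * Real.exp (s w)) :=
        mul_le_mul h2 h1 (abs_nonneg _) (Real.exp_pos _).le
    _ = _ := by ring

lemma IsExpEnvelope.integrable_exp_of (hs : IsExpEnvelope ρ s) (hZ : Dominated s Z) :
    Integrable (fun w => Real.exp (Z w)) ρ := by
  simpa using hs.integrable_exp_mul hZ (hs.dominated_const 1)

lemma IsExpEnvelope.integrable_of (hs : IsExpEnvelope ρ s) (hZ : Dominated s Z) :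
    Integrable Z ρ := by
  simpa using hs.integrable_exp_mul (hs.dominated_const 0) hZ

lemma IsExpEnvelope.integrable_tilted (hs : IsExpEnvelope ρ s) (hZ : Dominated s Z)
    (hφ : Dominated s φ) : Integrable φ (ρ.tilted Z) := by
  rw [integrable_tilted_iff (hs.integrable_exp_of hZ)]
  exact hs.integrable_exp_mul hZ hφ

variable [IsProbabilityMeasure ρ]

lemma IsExpEnvelope.integral_exp_pos (hs : IsExpEnvelope ρ s) (hZ : Dominated s Z) :
    0 < ∫ w, Real.exp (Z w) ∂ρ :=
  MeasureTheory.integral_exp_pos (hs.integrable_exp_of hZ)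

lemma integral_tilted_eq_div (ρ : Measure S) (Z φ : S → ℝ) :
    ∫ w, φ w ∂(ρ.tilted Z) = (∫ w, Real.exp (Z w) * φ w ∂ρ) / ∫ w, Real.exp (Z w) ∂ρ := by
  rw [integral_tilted, ← integral_div]
  congr 1 with w
  simp only [smul_eq_mul]
  ring

/-- Gibbs' variational inequality for log-Laplace transforms. -/
lemma IsExpEnvelope.integral_tilted_sub_le (hs : IsExpEnvelope ρ s) (h₁ : Dominated s Z₁)
    (h₂ : Dominated s Z₂) :
    ∫ w, (Z₁ w - Z₂ w) ∂(ρ.tilted Z₂) ≤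
      Real.log (∫ w, Real.exp (Z₁ w) ∂ρ) - Real.log (∫ w, Real.exp (Z₂ w) ∂ρ) := by
  have p₁ := hs.integral_exp_pos h₁
  have p₂ := hs.integral_exp_pos h₂
  have hd := h₁.sub h₂
  rw [← Real.log_div p₁.ne' p₂.ne', Real.le_log_iff_exp_le (div_pos p₁ p₂), le_div_iff₀ p₂]
  set c := ∫ w, (Z₁ w - Z₂ w) ∂(ρ.tilted Z₂) with hc
  rw [integral_tilted_eq_div, eq_div_iff p₂.ne'] at hc
  -- Pointwise, `exp Z₁ ≥ exp c * exp Z₂ * (1 + (Z₁ - Z₂ - c))`. Since `c` is the tilted mean of `Z₁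
  -- - Z₂`, the linear correction integrates to zero.
  have key : ∫ w, Real.exp c * (Real.exp (Z₂ w) * (Z₁ w - Z₂ w) + (1 - c) * Real.exp (Z₂ w)) ∂ρ ≤
      ∫ w, Real.exp (Z₁ w) ∂ρ := by
    refine integral_mono (((hs.integrable_exp_mul h₂ hd).add
      ((hs.integrable_exp_of h₂).const_mul _)).const_mul _) (hs.integrable_exp_of h₁) fun w => ?_
    have e : Real.exp (Z₁ w) = Real.exp c * Real.exp (Z₂ w) * Real.exp (Z₁ w - Z₂ w - c) := by
      rw [← Real.exp_add, ← Real.exp_add]; ring_nf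
    have := mul_le_mul_of_nonneg_left (Real.add_one_le_exp (Z₁ w - Z₂ w - c))
      (mul_pos (Real.exp_pos c) (Real.exp_pos (Z₂ w))).le
    simp only
    rw [e]
    linarith
  rw [integral_const_mul, integral_add (hs.integrable_exp_mul h₂ hd)
    ((hs.integrable_exp_of h₂).const_mul _), integral_const_mul, ← hc] at key
  linarith

/-- Jensen's inequality, as the case of Gibbs' inequality in which nothing is tilted. -/
lemma IsExpEnvelope.integral_le_log (hs : IsExpEnvelope ρ s) (h : Dominated s Z) :
    ∫ w, Z w ∂ρ ≤ Real.log (∫ w, Real.exp (Z w) ∂ρ) := by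
  simpa using hs.integral_tilted_sub_le h (hs.dominated_const 0)

lemma IsExpEnvelope.log_mono (hs : IsExpEnvelope ρ s) (h₁ : Dominated s Z₁)
    (h₂ : Dominated s Z₂) (h : ∀ w, Z₁ w ≤ Z₂ w) :
    Real.log (∫ w, Real.exp (Z₁ w) ∂ρ) ≤ Real.log (∫ w, Real.exp (Z₂ w) ∂ρ) :=
  Real.log_le_log (hs.integral_exp_pos h₁) (integral_mono (hs.integrable_exp_of h₁)
    (hs.integrable_exp_of h₂) fun w => Real.exp_le_exp.mpr (h w))

lemma IsExpEnvelope.log_add_const (hs : IsExpEnvelope ρ s) (h : Dominated s Z) (c : ℝ) :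
    Real.log (∫ w, Real.exp (Z w + c) ∂ρ) = Real.log (∫ w, Real.exp (Z w) ∂ρ) + c := by
  simp only [Real.exp_add]
  rw [integral_mul_const, Real.log_mul (hs.integral_exp_pos h).ne' (Real.exp_pos c).ne',
    Real.log_exp]

end ExpDominated

/-! ### Drift and overlap of the tilted kernels. -/

section Model

/-- The standing assumptions, expressed for a noise law `ρ`, a state space `X` and an action
space `A`. -/
structure IsModel {X A S : Type*} [TopologicalSpace X] [MeasurableSpace X] [TopologicalSpace A]
    [MeasurableSpace A] [MeasurableSpace S] (ρ : Measure S) (G : X → S → X) (F : X → A → S → ℝ)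
    (ω : X → ℝ) (a₁ a₂ : S → ℝ) (b₁ b₂ : ℝ) : Prop where
  measurable_G : Measurable fun p : X × S => G p.1 p.2
  continuous_G : ∀ w, Continuous fun x => G x w
  measurable_F : Measurable fun p : X × A × S => F p.1 p.2.1 p.2.2
  continuous_F : ∀ w, Continuous fun p : X × A => F p.1 p.2 w
  continuous_ω : Continuous ω
  ω_nonneg : ∀ x, 0 ≤ ω x
  a₁_nonneg : ∀ w, 0 ≤ a₁ w
  a₂_nonneg : ∀ w, 0 ≤ a₂ w
  measurable_a₁ : Measurable a₁
  measurable_a₂ : Measurable a₂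
  b₁_pos : 0 < b₁
  b₁_lt_one : b₁ < 1
  b₂_pos : 0 < b₂
  growth_G : ∀ x w, ω (G x w) ≤ a₁ w + b₁ * ω x
  growth_F : ∀ x h w, |F x h w| ≤ a₂ w + b₂ * ω x
  envelope : IsExpEnvelope ρ fun w => 1 + a₁ w + a₂ w

/-- Local minorization of the kernel `x ↦ law of G (x, ·)` on sublevel sets of `ω`. -/
def IsLocallyMinorized {X S : Type*} [MeasurableSpace X] [MeasurableSpace S] (ρ : Measure S)
    (G : X → S → X) (ω : X → ℝ) : Prop :=
  ∀ R : ℝ, 0 < R → ∃ c : ℝ, 0 < c ∧ ∃ ν : Measure X, IsProbabilityMeasure ν ∧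
    ∀ x, ω x ≤ R → ENNReal.ofReal c • ν ≤ ρ.map (G x)

variable {X A S : Type*} [TopologicalSpace X] [MeasurableSpace X]
  [TopologicalSpace A] [MeasurableSpace A] [MeasurableSpace S]
  {ρ : Measure S} {G : X → S → X} {F : X → A → S → ℝ} {ω : X → ℝ}
  {a₁ a₂ : S → ℝ} {b₁ b₂ : ℝ}

lemma IsModel.measurable_G_right (hM : IsModel ρ G F ω a₁ a₂ b₁ b₂) (x : X) :
    Measurable (G x) :=
  hM.measurable_G.comp (measurable_const.prodMk measurable_id)

lemma IsModel.measurable_F_right (hM : IsModel ρ G F ω a₁ a₂ b₁ b₂) (x : X) (h : A) :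
    Measurable (F x h) :=
  hM.measurable_F.comp (measurable_const.prodMk (measurable_const.prodMk measurable_id))

lemma IsModel.dominated_a₁ (hM : IsModel ρ G F ω a₁ a₂ b₁ b₂) :
    Dominated (fun w => 1 + a₁ w + a₂ w) a₁ :=
  ⟨hM.measurable_a₁, 1, fun w => by
    rw [abs_of_nonneg (hM.a₁_nonneg w)]; linarith [hM.a₂_nonneg w]⟩

lemma IsModel.dominated_of_le (hM : IsModel ρ G F ω a₁ a₂ b₁ b₂) {Z : S → ℝ} (hZ : Measurable Z)
    {D c : ℝ} (h : ∀ w, |Z w| ≤ D * (1 + a₁ w + a₂ w) + c) :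
    Dominated (fun w => 1 + a₁ w + a₂ w) Z := by
  refine ⟨hZ, D + |c|, fun w => (h w).trans ?_⟩
  have := le_mul_of_one_le_right (abs_nonneg c) (hM.envelope.one_le w)
  linarith [le_abs_self c]

lemma IsModel.dominated_comp (hM : IsModel ρ G F ω a₁ a₂ b₁ b₂) {φ : X → ℝ} (hφ : Measurable φ)
    {C : ℝ} (h : ∀ x, |φ x| ≤ C * (1 + ω x)) (x : X) :
    Dominated (fun w => 1 + a₁ w + a₂ w) (fun w => φ (G x w)) := by
  refine hM.dominated_of_le (D := |C|) (c := |C| * (b₁ * ω x))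
    (hφ.comp (hM.measurable_G_right x)) fun w => (h _).trans ?_
  have h1 := hM.growth_G x w
  have h2 := hM.a₂_nonneg w
  have h3 := hM.ω_nonneg (G x w)
  calc C * (1 + ω (G x w)) ≤ |C| * (1 + ω (G x w)) :=
        mul_le_mul_of_nonneg_right (le_abs_self C) (by linarith)
    _ ≤ |C| * ((1 + a₁ w + a₂ w) + b₁ * ω x) :=
        mul_le_mul_of_nonneg_left (by linarith) (abs_nonneg C)
    _ = _ := by ring

/-- A tilting exponent of size `D` at the state `x`. -/
def IsTilt (ω : X → ℝ) (a₁ a₂ : S → ℝ) (b D : ℝ) (x : X) (Z : S → ℝ) : Prop :=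
  Measurable Z ∧ ∀ w, |Z w| ≤ D * (1 + a₁ w + a₂ w) + D * b * ω x

/-- The function enters only through the product `γ f`, so a large `f` is admitted once `γ` is
small. The coefficient `b₁ + b₂` collects the growth of `ω` through `G` and through `F`. -/
lemma IsModel.isTilt (hM : IsModel ρ G F ω a₁ a₂ b₁ b₂) {γ D : ℝ} {f : X → ℝ}
    (hf : Measurable f) (hγ : |γ| ≤ D) (hfD : ∀ x, |γ * f x| ≤ D * (1 + ω x)) (x : X) (h : A) :
    IsTilt ω a₁ a₂ (b₁ + b₂) D x (fun w => γ * (F x h w + f (G x w))) := by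
  refine ⟨((hM.measurable_F_right x h).add (hf.comp (hM.measurable_G_right x))).const_mul γ,
    fun w => ?_⟩
  have hD : 0 ≤ D := (abs_nonneg γ).trans hγ
  have h1 : |γ * F x h w| ≤ D * (a₂ w + b₂ * ω x) := by
    rw [abs_mul]
    exact mul_le_mul hγ (hM.growth_F x h w) (abs_nonneg _) hD
  have h2 : |γ * f (G x w)| ≤ D * (1 + (a₁ w + b₁ * ω x)) :=
    (hfD _).trans (mul_le_mul_of_nonneg_left (by linarith [hM.growth_G x w]) hD)
  have h3 := abs_add_le (γ * F x h w) (γ * f (G x w))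
  rw [← mul_add] at h3
  linarith

lemma IsModel.dominated_of_isTilt (hM : IsModel ρ G F ω a₁ a₂ b₁ b₂) {b D : ℝ} {x : X} {Z : S → ℝ}
    (h : IsTilt ω a₁ a₂ b D x Z) : Dominated (fun w => 1 + a₁ w + a₂ w) Z :=
  hM.dominated_of_le h.1 h.2

variable [IsProbabilityMeasure ρ]

lemma IsModel.isProbabilityMeasure_tilted (hM : IsModel ρ G F ω a₁ a₂ b₁ b₂) {b D : ℝ} {x : X}
    {Z : S → ℝ} (h : IsTilt ω a₁ a₂ b D x Z) : IsProbabilityMeasure (ρ.tilted Z) :=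
  MeasureTheory.isProbabilityMeasure_tilted
    (hM.envelope.integrable_exp_of (hM.dominated_of_isTilt h))

lemma IsModel.const_mul_integral_le (hM : IsModel ρ G F ω a₁ a₂ b₁ b₂) {c : ℝ} (hc : 0 ≤ c)
    {ν : Measure X} [IsProbabilityMeasure ν] {x : X} (h : ENNReal.ofReal c • ν ≤ ρ.map (G x))
    {φ : X → ℝ} (hφ : Measurable φ) (h0 : ∀ y, 0 ≤ φ y) {C : ℝ} (hC : ∀ y, φ y ≤ C) :
    c * ∫ y, φ y ∂ν ≤ ∫ w, φ (G x w) ∂ρ := by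
  have hm := hM.measurable_G_right x
  have : IsProbabilityMeasure (ρ.map (G x)) := Measure.isProbabilityMeasure_map hm.aemeasurable
  have hint : Integrable φ (ρ.map (G x)) :=
    Integrable.of_bound hφ.aestronglyMeasurable C
      (ae_of_all _ fun y => by rw [Real.norm_eq_abs, abs_of_nonneg (h0 y)]; exact hC y)
  have := integral_mono_measure h (ae_of_all _ h0) hint
  rwa [integral_smul_measure, ENNReal.toReal_ofReal hc, smul_eq_mul,
    integral_map hm.aemeasurable hφ.aestronglyMeasurable] at this

/-- Uniform overlap of the tilted kernels on sublevel sets of `ω`. -/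
lemma IsModel.exists_overlap (hM : IsModel ρ G F ω a₁ a₂ b₁ b₂) (hN : IsLocallyMinorized ρ G ω)
    {D b R : ℝ} (hD : 0 ≤ D) (hb : 0 ≤ b) (hR : 0 < R) :
    ∃ α : ℝ, 0 < α ∧ α ≤ 1 ∧ ∀ x y Z Z', ω x ≤ R → ω y ≤ R → IsTilt ω a₁ a₂ b D x Z →
      IsTilt ω a₁ a₂ b D y Z' → ∀ (ψ : X → ℝ), Measurable ψ → ∀ M, 0 ≤ M → (∀ z, |ψ z| ≤ M) →
      ∫ w, ψ (G x w) ∂(ρ.tilted Z) - ∫ w, ψ (G y w) ∂(ρ.tilted Z') ≤ 2 * (1 - α) * M := by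
  obtain ⟨c, hc, ν, hν, hmin⟩ := hN R hR
  have hE := hM.envelope
  -- One envelope for all tilts of size `D` at all states with `ω ≤ R`.
  set s : S → ℝ := fun w => D * (1 + a₁ w + a₂ w) + D * b * R with hs
  have hds : Dominated (fun w => 1 + a₁ w + a₂ w) s :=
    (hE.dominated.const_mul D).add (hE.dominated_const _)
  have hs0 : ∀ w, 0 ≤ s w := fun w => by have := hE.pos w; positivity
  set I := ∫ w, s w ∂ρ with hI
  have hI0 : 0 ≤ I := integral_nonneg hs0
  -- Cutoff level: by Markov's inequality, discarding `s > N` costs at most half of the minorizing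
  -- mass `c`.
  set N := 4 * I / c + 1 with hNdef
  have hN0 : 0 < N := by positivity
  set B := ∫ w, Real.exp (s w) ∂ρ with hB
  have hB0 : 0 < B := hE.integral_exp_pos hds
  have htilt : ∀ x Z, ω x ≤ R → IsTilt ω a₁ a₂ b D x Z → ∀ φ : X → ℝ, Measurable φ →
      (∀ z, 0 ≤ φ z) → ∀ M, (∀ z, φ z ≤ 2 * M) →
      Real.exp (-N) / B * (c * ∫ z, φ z ∂ν - c / 2 * M) ≤ ∫ w, φ (G x w) ∂(ρ.tilted Z) := by
    intro x Z hx hZ φ hφ h0 M hφM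
    have hdZ := hM.dominated_of_isTilt hZ
    have hZs : ∀ w, |Z w| ≤ s w := fun w => (hZ.2 w).trans
      (by have := mul_le_mul_of_nonneg_left hx (mul_nonneg hD hb); simp only [hs]; linarith)
    have hM0 : 0 ≤ M := by
      obtain ⟨z⟩ := nonempty_of_isProbabilityMeasure ν
      linarith [h0 z, hφM z]
    have hdφ : Dominated (fun w => 1 + a₁ w + a₂ w) (fun w => φ (G x w)) :=
      hM.dominated_comp hφ (C := 2 * M) (fun z => by
        rw [abs_of_nonneg (h0 z)]
        exact (hφM z).trans (le_mul_of_one_le_right (by linarith)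
          (by linarith [hM.ω_nonneg z]))) x
    have hpos := hE.integral_exp_pos hdZ
    have hle : ∫ w, Real.exp (Z w) ∂ρ ≤ B := integral_mono (hE.integrable_exp_of hdZ)
      (hE.integrable_exp_of hds) fun w => Real.exp_le_exp.mpr ((le_abs_self _).trans (hZs w))
    rw [integral_tilted_eq_div]
    have hnum0 : 0 ≤ ∫ w, Real.exp (Z w) * φ (G x w) ∂ρ :=
      integral_nonneg fun w => mul_nonneg (Real.exp_pos _).le (h0 _)
    have hnum : Real.exp (-N) * (c * ∫ z, φ z ∂ν - c / 2 * M) ≤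
        ∫ w, Real.exp (Z w) * φ (G x w) ∂ρ := by
      have hd2 := (hdφ.sub (hds.const_mul (2 * M / N))).const_mul (Real.exp (-N))
      -- Where `s ≤ N` the density is at least `exp (-N)`; where `s ≥ N` the left integrand is
      -- nonpositive because `φ ≤ 2 M`.
      have h1 : ∫ w, Real.exp (-N) * (φ (G x w) - 2 * M / N * s w) ∂ρ ≤
          ∫ w, Real.exp (Z w) * φ (G x w) ∂ρ := by
        refine integral_mono (hE.integrable_of hd2) (hE.integrable_exp_mul hdZ hdφ) fun w => ?_
        show Real.exp (-N) * (φ (G x w) - 2 * M / N * s w) ≤ Real.exp (Z w) * φ (G x w)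
        have hr : 0 ≤ 2 * M / N := by positivity
        rcases le_total (s w) N with hle | hle
        · have h2 : 0 ≤ 2 * M / N * s w := mul_nonneg hr (hs0 w)
          calc _ ≤ Real.exp (-N) * φ (G x w) :=
                mul_le_mul_of_nonneg_left (by linarith) (Real.exp_pos _).le
            _ ≤ _ := mul_le_mul_of_nonneg_right (Real.exp_le_exp.mpr
                (by linarith [(abs_le.mp (hZs w)).1])) (h0 _)
        · have h2 : 2 * M ≤ 2 * M / N * s w := by
            calc 2 * M = 2 * M / N * N := by field_simp
              _ ≤ _ := mul_le_mul_of_nonneg_left hle hr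
          have h3 : φ (G x w) - 2 * M / N * s w ≤ 0 := by linarith [hφM (G x w)]
          exact (mul_nonpos_of_nonneg_of_nonpos (Real.exp_pos _).le h3).trans
            (mul_nonneg (Real.exp_pos _).le (h0 _))
      rw [integral_const_mul, integral_sub (hE.integrable_of hdφ)
        (hE.integrable_of (hds.const_mul _)), integral_const_mul] at h1
      refine le_trans (mul_le_mul_of_nonneg_left ?_ (Real.exp_pos _).le) h1
      have h4 := hM.const_mul_integral_le hc.le (hmin x hx) hφ h0 hφM
      have h5 : 2 * M / N * I ≤ c / 2 * M := by
        rw [div_mul_eq_mul_div, div_le_iff₀ hN0, hNdef]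
        have : c / 2 * M * (4 * I / c + 1) = 2 * M * I + c / 2 * M := by field_simp; ring
        rw [this]
        have : 0 ≤ c / 2 * M := by positivity
        linarith
      linarith
    rcases le_total 0 (c * ∫ z, φ z ∂ν - c / 2 * M) with hp | hp
    · rw [div_mul_eq_mul_div]
      exact (div_le_div_of_nonneg_right hnum hB0.le).trans
        (div_le_div_of_nonneg_left hnum0 hpos hle)
    · exact (mul_nonpos_of_nonneg_of_nonpos (by positivity) hp).trans
        (div_nonneg hnum0 hpos.le)
  refine ⟨min 1 (Real.exp (-N) / B * c / 2), by positivity, min_le_left _ _, ?_⟩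
  intro x y Z Z' hx hy hZ hZ' ψ hψ M hM0 hψM
  have i1 := hM.isProbabilityMeasure_tilted hZ
  have i2 := hM.isProbabilityMeasure_tilted hZ'
  have hint : ∀ x (μ : Measure S) [IsProbabilityMeasure μ], Integrable (fun w => ψ (G x w)) μ :=
    fun x μ _ => Integrable.of_bound (hψ.comp (hM.measurable_G_right x)).aestronglyMeasurable M
      (ae_of_all _ fun w => hψM _)
  have hψν : Integrable ψ ν := Integrable.of_bound hψ.aestronglyMeasurable M
      (ae_of_all _ fun w => hψM _)
  -- The lower bound is applied to `M - ψ` at `x` and to `M + ψ` at `y`. In the sum `ψ` cancels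
  -- under `ν`, leaving `c * (2 M) - c * M = c * M`.
  have h1 := htilt x Z hx hZ (fun z => M - ψ z) (measurable_const.sub hψ)
    (fun z => by linarith [(abs_le.mp (hψM z)).2]) M (fun z => by linarith [(abs_le.mp (hψM z)).1])
  have h2 := htilt y Z' hy hZ' (fun z => M + ψ z) (measurable_const.add hψ)
    (fun z => by linarith [(abs_le.mp (hψM z)).1]) M (fun z => by linarith [(abs_le.mp (hψM z)).2])
  rw [integral_sub (integrable_const _) (hint x _), integral_sub (integrable_const _) hψν] at h1
  rw [integral_add (integrable_const _) (hint y _), integral_add (integrable_const _) hψν] at h2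
  simp only [integral_const, probReal_univ, smul_eq_mul, one_mul] at h1 h2
  have h3 : min 1 (Real.exp (-N) / B * c / 2) * (2 * M) ≤ Real.exp (-N) / B * c / 2 * (2 * M) :=
    mul_le_mul_of_nonneg_right (min_le_right _ _) (by linarith)
  linarith

variable [BorelSpace X]

/-- Drift condition for the tilted kernels, uniformly over tilts of size `D`. -/
lemma IsModel.exists_drift (hM : IsModel ρ G F ω a₁ a₂ b₁ b₂) {D b : ℝ} (hD : 0 ≤ D) (hb : 0 ≤ b) :
    ∃ K : ℝ, 0 ≤ K ∧ ∀ x Z, IsTilt ω a₁ a₂ b D x Z →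
      ∫ w, ω (G x w) ∂(ρ.tilted Z) ≤ (1 + b₁) / 2 * ω x + K := by
  have hb1 : 0 < 1 - b₁ := sub_pos.mpr hM.b₁_lt_one
  -- Large enough that the tilt, whose effect is `2 D b ω x / θ`, uses at most half of the gap `1 -
  -- b₁`.
  set θ := (4 * D * b + 1) / (1 - b₁) with hθ
  have hθ0 : 0 < θ := by positivity
  have hE := hM.envelope
  have hds := hE.dominated
  set T := Real.log (∫ w, Real.exp (θ * a₁ w + D * (1 + a₁ w + a₂ w)) ∂ρ) with hT
  set I := ∫ w, (1 + a₁ w + a₂ w) ∂ρ with hI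
  refine ⟨|(T + D * I) / θ|, abs_nonneg _, fun x Z hZ => ?_⟩
  have hdZ := hM.dominated_of_isTilt hZ
  have hda := hM.dominated_a₁
  have := hM.isProbabilityMeasure_tilted hZ
  have hω0 := hM.ω_nonneg x
  -- Gibbs' inequality between `θ a₁ + Z` and `Z` bounds `θ` times the tilted mean of `a₁` by a
  -- difference of two cumulants, each under control.
  have h1 := hE.integral_tilted_sub_le ((hda.const_mul θ).add hdZ) hdZ
  simp only [add_sub_cancel_right] at h1
  rw [integral_const_mul] at h1
  have h2 : Real.log (∫ w, Real.exp (θ * a₁ w + Z w) ∂ρ) ≤ T + D * b * ω x := by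
    rw [hT, ← hE.log_add_const ((hda.const_mul θ).add (hds.const_mul D))]
    refine hE.log_mono ((hda.const_mul θ).add hdZ)
      (((hda.const_mul θ).add (hds.const_mul D)).add (hE.dominated_const _)) fun w => ?_
    linarith [(abs_le.mp (hZ.2 w)).2]
  have h3 : -(D * I + D * b * ω x) ≤ Real.log (∫ w, Real.exp (Z w) ∂ρ) := by
    refine le_trans ?_ (hE.integral_le_log hdZ)
    have hi : Integrable (fun w => -D * (1 + a₁ w + a₂ w)) ρ :=
      (hE.integrable_of hds).const_mul (-D)
    have : ∫ w, (-D * (1 + a₁ w + a₂ w) + -(D * b * ω x)) ∂ρ ≤ ∫ w, Z w ∂ρ := by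
      refine integral_mono (hi.add (integrable_const _)) (hE.integrable_of hdZ) fun w => ?_
      show -D * (1 + a₁ w + a₂ w) + -(D * b * ω x) ≤ Z w
      linarith [(abs_le.mp (hZ.2 w)).1]
    rw [integral_add hi (integrable_const _), integral_const_mul] at this
    simp only [integral_const, probReal_univ, smul_eq_mul, one_mul] at this
    linarith
  have h4 : ∫ w, a₁ w ∂(ρ.tilted Z) ≤ (1 - b₁) / 2 * ω x + |(T + D * I) / θ| := by
    have h5 : ∫ w, a₁ w ∂(ρ.tilted Z) ≤ (2 * D * b * ω x + (T + D * I)) / θ := by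
      rw [le_div_iff₀ hθ0]; linarith
    have h6 : 2 * D * b * ω x / θ ≤ (1 - b₁) / 2 * ω x := by
      rw [div_le_iff₀ hθ0, hθ]
      field_simp
      nlinarith
    rw [add_div] at h5
    linarith [le_abs_self ((T + D * I) / θ)]
  have h5 : ∫ w, ω (G x w) ∂(ρ.tilted Z) ≤ ∫ w, (a₁ w + b₁ * ω x) ∂(ρ.tilted Z) := by
    refine integral_mono (hE.integrable_tilted hdZ (hM.dominated_comp (C := 1)
      hM.continuous_ω.measurable (fun y => ?_) x)) ((hE.integrable_tilted hdZ hda).add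
      (integrable_const _)) fun w => hM.growth_G x w
    rw [abs_of_nonneg (hM.ω_nonneg y)]; linarith
  rw [integral_add (hE.integrable_tilted hdZ hda) (integrable_const _)] at h5
  simp only [integral_const, probReal_univ, smul_eq_mul, one_mul] at h5
  linarith

end Model

/-! ### Weighted oscillation and weighted supremum norm. -/

section Oscillation

variable {X : Type*} {ω : X → ℝ}

/-- `M` bounds the `β`-weighted oscillation of `φ`. -/
def OscBound (ω : X → ℝ) (β M : ℝ) (φ : X → ℝ) : Prop :=
  ∀ x y, φ x - φ y ≤ M * (2 + β * ω x + β * ω y)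

/-- The intervals of radius `M (1 + β ω z)` around `φ z` meet pairwise, hence have a common point;
the infimum of their right endpoints is one. -/
lemma OscBound.exists_center [Nonempty X] {β M : ℝ} {φ : X → ℝ} (h : OscBound ω β M φ) :
    ∃ c, ∀ z, |φ z - c| ≤ M * (1 + β * ω z) := by
  have hlow : ∀ x y, φ x - M * (1 + β * ω x) ≤ φ y + M * (1 + β * ω y) := fun x y => by
    linarith [h x y]
  refine ⟨⨅ y, (φ y + M * (1 + β * ω y)), fun z => ?_⟩
  have h1 : ⨅ y, (φ y + M * (1 + β * ω y)) ≤ φ z + M * (1 + β * ω z) :=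
    ciInf_le ⟨φ z - M * (1 + β * ω z), by rintro _ ⟨y, rfl⟩; exact hlow z y⟩ z
  have h2 : φ z - M * (1 + β * ω z) ≤ ⨅ y, (φ y + M * (1 + β * ω y)) := le_ciInf (hlow z)
  rw [abs_le]
  constructor <;> linarith

end Oscillation

/-! ### Contraction of the tilted kernels and of the Bellman operator. -/

section Contraction

variable {X A S : Type*} [TopologicalSpace X] [MeasurableSpace X] [BorelSpace X]
  [TopologicalSpace A] [MeasurableSpace A] [MeasurableSpace S]
  {ρ : Measure S} {G : X → S → X} {F : X → A → S → ℝ} {ω : X → ℝ}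
  {a₁ a₂ : S → ℝ} {b₁ b₂ : ℝ}

/-- Continuous functions of at most linear growth in `ω`. -/
def GrowsLinearly (ω : X → ℝ) (f : X → ℝ) : Prop :=
  Continuous f ∧ ∃ C : ℝ, ∀ x, |f x| ≤ C * (1 + ω x)

lemma IsModel.dominated_exponent (hM : IsModel ρ G F ω a₁ a₂ b₁ b₂) (γ : ℝ) {f : X → ℝ}
    (hf : GrowsLinearly ω f) (x : X) (h : A) :
    Dominated (fun w => 1 + a₁ w + a₂ w) (fun w => γ * (F x h w + f (G x w))) := by
  obtain ⟨hc, C, hC⟩ := hf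
  refine Dominated.const_mul (Dominated.add ?_ (hM.dominated_comp hc.measurable hC x)) γ
  refine hM.dominated_of_le (D := 1) (c := b₂ * ω x) (hM.measurable_F_right x h) fun w => ?_
  linarith [hM.growth_F x h w, hM.a₁_nonneg w]

variable [IsProbabilityMeasure ρ]

/-- The tilted kernels contract the weighted oscillation. -/
lemma IsModel.exists_kernel_contraction (hM : IsModel ρ G F ω a₁ a₂ b₁ b₂)
    (hN : IsLocallyMinorized ρ G ω) {D b : ℝ} (hD : 0 ≤ D) (hb : 0 ≤ b) :
    ∃ β L : ℝ, 0 < β ∧ β ≤ 1 ∧ 0 < L ∧ L < 1 ∧ ∀ x y Z Z', IsTilt ω a₁ a₂ b D x Z →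
      IsTilt ω a₁ a₂ b D y Z' → ∀ (φ : X → ℝ), Measurable φ → ∀ M, 0 ≤ M →
      (∀ z, |φ z| ≤ M * (1 + β * ω z)) →
      ∫ w, φ (G x w) ∂(ρ.tilted Z) - ∫ w, φ (G y w) ∂(ρ.tilted Z') ≤
        L * (M * (2 + β * ω x + β * ω y)) := by
  obtain ⟨K, hK, hdrift⟩ := hM.exists_drift hD hb
  have hb1 := hM.b₁_lt_one
  have hb0 := hM.b₁_pos
  set b' := (1 + b₁) / 2 with hb'
  have hb'1 : 0 < 1 - b' := by rw [hb']; linarith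
  have hb'0 : 0 < b' := by rw [hb']; linarith
  -- Above level `R` for `ω x + ω y`, half of the drift gap `1 - b'` absorbs the constant `2 K`.
  set R := 4 * K / (1 - b') + 1 with hRdef
  have hR : 0 < R := by positivity
  have hKR : 2 * K ≤ (1 - b') / 2 * R := by
    have : (1 - b') / 2 * R = 2 * K + (1 - b') / 2 := by rw [hRdef]; field_simp; ring
    linarith
  obtain ⟨α, hα0, hα1, hover⟩ := hM.exists_overlap hN hD hb hR
  -- A small weight: below level `R` the drift constant then spends at most half of the overlap gain
  -- `2 α`.
  set β := min 1 (α / (2 * K + 1)) with hβ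
  have hβ0 : 0 < β := by positivity
  have hβK : β * (2 * K) ≤ α := by
    have h1 : β * (2 * K + 1) ≤ α := by
      rw [← le_div_iff₀ (by positivity)]; exact min_le_right _ _
    linarith
  set b'' := (1 + b') / 2 with hb''
  have hb''1 : b'' < 1 := by rw [hb'']; linarith
  -- The first two entries serve pairs with `ω x + ω y ≤ R`, the last one the remaining pairs.
  set L := max (max (1 - α / 2) b') ((2 + β * b'' * R) / (2 + β * R)) with hL
  have hL1 : 1 - α / 2 ≤ L := (le_max_left _ _).trans (le_max_left _ _)
  have hL2 : b' ≤ L := (le_max_right _ _).trans (le_max_left _ _)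
  have hL3 : 2 + β * b'' * R ≤ L * (2 + β * R) := by
    rw [← div_le_iff₀ (by positivity)]; exact le_max_right _ _
  have hLlt : L < 1 := by
    refine max_lt (max_lt (by linarith) (by linarith)) ?_
    rw [div_lt_one (by positivity)]
    nlinarith [mul_pos hβ0 hR]
  refine ⟨β, L, hβ0, min_le_left _ _, hb'0.trans_le hL2, hLlt, ?_⟩
  intro x y Z Z' hZ hZ' φ hφ M hM0 hφM
  have i1 := hM.isProbabilityMeasure_tilted hZ
  have i2 := hM.isProbabilityMeasure_tilted hZ'
  have hx := hM.ω_nonneg x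
  have hy := hM.ω_nonneg y
  have hE := hM.envelope
  have hMβ : 0 ≤ M * β := mul_nonneg hM0 hβ0.le
  have hφM' : ∀ z, |φ z| ≤ M * (1 + ω z) := fun z => (hφM z).trans
    (mul_le_mul_of_nonneg_left (by nlinarith [hM.ω_nonneg z, min_le_left 1 (α / (2 * K + 1))]) hM0)
  have hωint : ∀ x Z, IsTilt ω a₁ a₂ b D x Z → Integrable (fun w => ω (G x w)) (ρ.tilted Z) :=
    fun x Z hZ => hE.integrable_tilted (hM.dominated_of_isTilt hZ) (hM.dominated_comp (C := 1)
      hM.continuous_ω.measurable (fun y => by rw [abs_of_nonneg (hM.ω_nonneg y)]; linarith) x)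
  have hφint : ∀ x Z, IsTilt ω a₁ a₂ b D x Z → Integrable (fun w => φ (G x w)) (ρ.tilted Z) :=
    fun x Z hZ => hE.integrable_tilted (hM.dominated_of_isTilt hZ) (hM.dominated_comp hφ hφM' x)
  have hdx := mul_le_mul_of_nonneg_left (hdrift x Z hZ) hMβ
  have hdy := mul_le_mul_of_nonneg_left (hdrift y Z' hZ') hMβ
  have hstep : ∫ w, φ (G x w) ∂(ρ.tilted Z) - ∫ w, φ (G y w) ∂(ρ.tilted Z') ≤
      L * (M * (2 + β * (ω x + ω y))) := by
    rcases le_total (ω x + ω y) R with hS | hS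
    -- Near the centre, the truncation to `[-M, M]` contracts by overlap, and the remainder is at
    -- most `M β ω`, which the drift controls.
    · set ψ : X → ℝ := fun z => max (-M) (min M (φ z)) with hψ
      have hψm : Measurable ψ := measurable_const.max (measurable_const.min hφ)
      have hψM : ∀ z, |ψ z| ≤ M := fun z => abs_le.mpr
        ⟨le_max_left _ _, max_le (by linarith) (min_le_left _ _)⟩
      have hdiff : ∀ z, |φ z - ψ z| ≤ M * β * ω z := by
        intro z
        have h1 := abs_le.mp (hφM z)
        have h2 : 0 ≤ M * β * ω z := mul_nonneg hMβ (hM.ω_nonneg z)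
        rw [abs_le]
        simp only [hψ]
        rcases le_total M (φ z) with h3 | h3
        · rw [min_eq_left h3, max_eq_right (by linarith)]
          constructor <;> linarith
        · rw [min_eq_right h3]
          rcases le_total (-M) (φ z) with h4 | h4
          · rw [max_eq_right h4]; constructor <;> linarith
          · rw [max_eq_left h4]; constructor <;> linarith
      have hψint : ∀ x (μ : Measure S) [IsProbabilityMeasure μ],
          Integrable (fun w => ψ (G x w)) μ := fun x μ _ =>
        Integrable.of_bound (hψm.comp (hM.measurable_G_right x)).aestronglyMeasurable M
          (ae_of_all _ fun w => hψM _)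
      have h1 : ∫ w, φ (G x w) ∂(ρ.tilted Z) ≤
          ∫ w, ψ (G x w) ∂(ρ.tilted Z) + M * β * ∫ w, ω (G x w) ∂(ρ.tilted Z) := by
        rw [← integral_const_mul, ← integral_add (hψint x _) ((hωint x Z hZ).const_mul _)]
        exact integral_mono (hφint x Z hZ) ((hψint x _).add ((hωint x Z hZ).const_mul _))
          fun w => by
            show φ (G x w) ≤ ψ (G x w) + M * β * ω (G x w)
            linarith [(abs_le.mp (hdiff (G x w))).2]
      have h2 : ∫ w, ψ (G y w) ∂(ρ.tilted Z') ≤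
          ∫ w, φ (G y w) ∂(ρ.tilted Z') + M * β * ∫ w, ω (G y w) ∂(ρ.tilted Z') := by
        rw [← integral_const_mul, ← integral_add (hφint y Z' hZ') ((hωint y Z' hZ').const_mul _)]
        exact integral_mono (hψint y _) ((hφint y Z' hZ').add ((hωint y Z' hZ').const_mul _))
          fun w => by
            show ψ (G y w) ≤ φ (G y w) + M * β * ω (G y w)
            linarith [(abs_le.mp (hdiff (G y w))).1]
      have h3 := hover x y Z Z' (by linarith) (by linarith) hZ hZ' ψ hψm M hM0 hψM
      have h4 : M * (2 * (1 - α / 2)) ≤ M * (2 * L) :=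
        mul_le_mul_of_nonneg_left (by linarith) hM0
      have h5 : M * β * (b' * (ω x + ω y)) ≤ M * β * (L * (ω x + ω y)) :=
        mul_le_mul_of_nonneg_left (mul_le_mul_of_nonneg_right hL2 (by linarith)) hMβ
      have h6 := mul_le_mul_of_nonneg_left hβK hM0
      linarith
    -- Far out, the drift alone suffices.
    · have h1 : ∫ w, φ (G x w) ∂(ρ.tilted Z) ≤ M + M * β * ∫ w, ω (G x w) ∂(ρ.tilted Z) := by
        have h2 : ∫ w, φ (G x w) ∂(ρ.tilted Z) ≤ ∫ w, (M + M * β * ω (G x w)) ∂(ρ.tilted Z) :=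
          integral_mono (hφint x Z hZ)
            ((integrable_const M).add ((hωint x Z hZ).const_mul (M * β))) fun w => by
              show φ (G x w) ≤ M + M * β * ω (G x w)
              linarith [(abs_le.mp (hφM (G x w))).2]
        rw [integral_add (integrable_const M) ((hωint x Z hZ).const_mul _),
          integral_const_mul] at h2
        simpa using h2
      have h2 : -(M + M * β * ∫ w, ω (G y w) ∂(ρ.tilted Z')) ≤ ∫ w, φ (G y w) ∂(ρ.tilted Z') := by
        have h2 : ∫ w, -(M + M * β * ω (G y w)) ∂(ρ.tilted Z') ≤ ∫ w, φ (G y w) ∂(ρ.tilted Z') :=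
          integral_mono ((integrable_const M).add ((hωint y Z' hZ').const_mul (M * β))).neg
            (hφint y Z' hZ') fun w => by
              show -(M + M * β * ω (G y w)) ≤ φ (G y w)
              linarith [(abs_le.mp (hφM (G y w))).1]
        rw [integral_neg, integral_add (integrable_const M) ((hωint y Z' hZ').const_mul _),
          integral_const_mul] at h2
        simpa using h2
      -- True at `ω x + ω y = R` by `hL3`, and preserved for larger sums because `b'' ≤ L`.
      have h3 : 2 + β * b'' * (ω x + ω y) ≤ L * (2 + β * (ω x + ω y)) := by
        have hLb : b'' ≤ L := by
          by_contra hlt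
          push Not at hlt
          nlinarith [mul_pos hβ0 hR]
        have : 0 ≤ (L - b'') * (β * (ω x + ω y - R)) :=
          mul_nonneg (by linarith) (mul_nonneg hβ0.le (by linarith))
        linarith
      have h4 := mul_le_mul_of_nonneg_left h3 hM0
      have h5 : M * β * (2 * K) ≤ M * β * ((1 - b') / 2 * (ω x + ω y)) :=
        mul_le_mul_of_nonneg_left (hKR.trans (mul_le_mul_of_nonneg_left hS (by linarith))) hMβ
      rw [hb''] at h4
      linarith
  linarith

/-- `μ^γ(F(x, h, ·) + f(G(x, ·)))` as a real number. -/
noncomputable def util (ρ : Measure S) (G : X → S → X) (F : X → A → S → ℝ) (γ : ℝ) (f : X → ℝ)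
    (x : X) (h : A) : ℝ :=
  (1 / γ) * Real.log (∫ w, Real.exp (γ * (F x h w + f (G x w))) ∂ρ)

/-- The Bellman operator. -/
noncomputable def bellman (ρ : Measure S) (G : X → S → X) (F : X → A → S → ℝ) (γ : ℝ) (f : X → ℝ)
    (x : X) : ℝ :=
  sSup (util ρ G F γ f x '' Set.univ)

lemma IsModel.integral_eq_exp_util (hM : IsModel ρ G F ω a₁ a₂ b₁ b₂) {γ : ℝ} (hγ : γ < 0)
    {f : X → ℝ} (hf : GrowsLinearly ω f) (x : X) (h : A) :
    ∫ w, Real.exp (γ * (F x h w + f (G x w))) ∂ρ = Real.exp (γ * util ρ G F γ f x h) := by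
  rw [util, ← mul_assoc, mul_one_div_cancel hγ.ne, one_mul,
    Real.exp_log (hM.envelope.integral_exp_pos (hM.dominated_exponent γ hf x h))]

lemma IsModel.util_add_const (hM : IsModel ρ G F ω a₁ a₂ b₁ b₂) {γ : ℝ} (hγ : γ < 0)
    {f : X → ℝ} (hf : GrowsLinearly ω f) (c : ℝ) (x : X) (h : A) :
    util ρ G F γ (fun z => f z + c) x h = util ρ G F γ f x h + c := by
  have := hM.envelope.log_add_const (hM.dominated_exponent γ hf x h) (γ * c)
  simp only [util]
  rw [show (∫ w, Real.exp (γ * (F x h w + (f (G x w) + c))) ∂ρ) =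
    ∫ w, Real.exp (γ * (F x h w + f (G x w)) + γ * c) ∂ρ by congr 1 with w; ring_nf, this,
    mul_add, ← mul_assoc, one_div_mul_cancel hγ.ne, one_mul]

/-- The utility is concave: its increments are dominated by tilted expectations. -/
lemma IsModel.util_sub_le (hM : IsModel ρ G F ω a₁ a₂ b₁ b₂) {γ : ℝ} (hγ : γ < 0)
    {f g : X → ℝ} (hf : GrowsLinearly ω f) (hg : GrowsLinearly ω g) (x : X) (h : A) :
    util ρ G F γ f x h - util ρ G F γ g x h ≤
      ∫ w, (f (G x w) - g (G x w)) ∂(ρ.tilted fun w => γ * (F x h w + g (G x w))) := by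
  have := hM.envelope.integral_tilted_sub_le (hM.dominated_exponent γ hf x h)
    (hM.dominated_exponent γ hg x h)
  simp only [← mul_sub, add_sub_add_left_eq_sub] at this
  rw [integral_const_mul] at this
  simp only [util]
  -- Dividing by `γ < 0` reverses Gibbs' inequality; the tilt is therefore by the subtracted
  -- function `g`.
  rw [← mul_sub, one_div, ← div_eq_inv_mul, div_le_iff_of_neg hγ]
  linarith

variable [FirstCountableTopology X] [FirstCountableTopology A]

lemma IsModel.continuous_util (hM : IsModel ρ G F ω a₁ a₂ b₁ b₂) {γ : ℝ}
    {f : X → ℝ} (hf : GrowsLinearly ω f) :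
    Continuous fun p : X × A => util ρ G F γ f p.1 p.2 := by
  refine continuous_const.mul (Continuous.log ?_ fun p =>
    (hM.envelope.integral_exp_pos (hM.dominated_exponent γ hf p.1 p.2)).ne')
  rw [continuous_iff_continuousAt]
  intro p
  obtain ⟨hc, C, hC⟩ := id hf
  -- On this neighbourhood `ω` is bounded, which gives a single integrable majorant for dominated
  -- convergence.
  have hnear : ∀ᶠ q : X × A in nhds p, ω q.1 < ω p.1 + 1 :=
    (hM.continuous_ω.comp continuous_fst).continuousAt.eventually_lt continuousAt_const
      (lt_add_one _)
  have hD : Dominated (fun w => 1 + a₁ w + a₂ w) (fun w =>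
      |γ| * ((1 + |C|) * (1 + a₁ w + a₂ w) + (b₂ + |C| * b₁) * (ω p.1 + 1))) :=
    ((hM.envelope.dominated.const_mul _).add (hM.envelope.dominated_const _)).const_mul _
  refine continuousAt_of_dominated (Eventually.of_forall fun q =>
    (hM.dominated_exponent γ hf q.1 q.2).1.exp.aestronglyMeasurable) ?_
    (hM.envelope.integrable_exp_of hD) (ae_of_all _ fun w => ?_)
  · filter_upwards [hnear] with q hq
    refine ae_of_all _ fun w => ?_
    rw [Real.norm_eq_abs, Real.abs_exp, Real.exp_le_exp]
    refine (le_abs_self _).trans ?_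
    rw [abs_mul]
    refine mul_le_mul_of_nonneg_left ?_ (abs_nonneg γ)
    have h1 := hM.growth_F q.1 q.2 w
    have h2 := hM.growth_G q.1 w
    have h3 := hM.a₁_nonneg w
    have h4 := hM.a₂_nonneg w
    have h5 : |f (G q.1 w)| ≤ |C| * (1 + a₁ w + a₂ w + b₁ * (ω p.1 + 1)) := by
      refine (hC _).trans ((mul_le_mul_of_nonneg_right (le_abs_self C)
        (by linarith [hM.ω_nonneg (G q.1 w)])).trans
        (mul_le_mul_of_nonneg_left ?_ (abs_nonneg C)))
      have := mul_le_mul_of_nonneg_left hq.le hM.b₁_pos.le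
      linarith
    have h6 := mul_le_mul_of_nonneg_left hq.le hM.b₂_pos.le
    refine (abs_add_le _ _).trans ?_
    linarith
  · have h1 := hM.continuous_F w
    have h2 := hc.comp ((hM.continuous_G w).comp (continuous_fst (X := X) (Y := A)))
    exact (Real.continuous_exp.comp (continuous_const.mul (h1.add h2))).continuousAt

variable [CompactSpace A]

lemma IsModel.continuous_bellman (hM : IsModel ρ G F ω a₁ a₂ b₁ b₂) {γ : ℝ}
    {f : X → ℝ} (hf : GrowsLinearly ω f) : Continuous (bellman ρ G F γ f) :=
  isCompact_univ.continuous_sSup (hM.continuous_util hf)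

lemma IsModel.exists_bellman_eq [Nonempty A] (hM : IsModel ρ G F ω a₁ a₂ b₁ b₂) {γ : ℝ}
    {f : X → ℝ} (hf : GrowsLinearly ω f) (x : X) :
    ∃ h, bellman ρ G F γ f x = util ρ G F γ f x h := by
  obtain ⟨h, -, hh⟩ := isCompact_univ.exists_sSup_image_eq Set.univ_nonempty
    ((hM.continuous_util (γ := γ) hf).comp (Continuous.prodMk_right x)).continuousOn
  exact ⟨h, hh⟩

lemma IsModel.util_le_bellman (hM : IsModel ρ G F ω a₁ a₂ b₁ b₂) {γ : ℝ}
    {f : X → ℝ} (hf : GrowsLinearly ω f) (x : X) (h : A) :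
    util ρ G F γ f x h ≤ bellman ρ G F γ f x :=
  le_csSup (isCompact_univ.image ((hM.continuous_util (γ := γ) hf).comp
    (Continuous.prodMk_right x))).bddAbove ⟨h, Set.mem_univ h, rfl⟩

/-- Local contraction property of the Bellman operator with respect to the weighted oscillation,
uniformly over risk parameters and functions of size controlled by `D`. -/
lemma IsModel.exists_bellman_contraction [Nonempty X] [Nonempty A] (hM : IsModel ρ G F ω a₁ a₂ b₁ b₂)
    (hN : IsLocallyMinorized ρ G ω) {D : ℝ} (hD : 0 ≤ D) :
    ∃ β L : ℝ, 0 < β ∧ β ≤ 1 ∧ 0 < L ∧ L < 1 ∧ ∀ γ, γ < 0 → |γ| ≤ D → ∀ f g : X → ℝ,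
      GrowsLinearly ω f → GrowsLinearly ω g → (∀ x, |γ * f x| ≤ D * (1 + ω x)) →
      (∀ x, |γ * g x| ≤ D * (1 + ω x)) → ∀ M, 0 ≤ M → OscBound ω β M (fun x => f x - g x) →
      OscBound ω β (L * M) (fun x => bellman ρ G F γ f x - bellman ρ G F γ g x) := by
  obtain ⟨β, L, hβ, hβ1, hL, hL1, hcon⟩ := hM.exists_kernel_contraction hN hD
    (add_nonneg hM.b₁_pos.le hM.b₂_pos.le)
  refine ⟨β, L, hβ, hβ1, hL, hL1, fun γ hγ hγD f g hf hg hfD hgD M hM0 hosc => ?_⟩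
  obtain ⟨c, hc⟩ := hosc.exists_center
  intro x y
  -- Each action is optimal for the function that enters with a plus sign. The two resulting tilts
  -- differ, in action and in base function, so the kernel contraction has to allow arbitrary pairs
  -- of tilts.
  obtain ⟨h, hh⟩ := hM.exists_bellman_eq (γ := γ) hf x
  obtain ⟨h', hh'⟩ := hM.exists_bellman_eq (γ := γ) hg y
  have h1 := hM.util_sub_le hγ hf hg x h
  have h2 := hM.util_sub_le hγ hg hf y h'
  have h3 := hM.util_le_bellman (γ := γ) hg x h
  have h4 := hM.util_le_bellman (γ := γ) hf y h'
  have t1 := hM.isTilt hg.1.measurable hγD hgD x h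
  have t2 := hM.isTilt hf.1.measurable hγD hfD y h'
  have h5 := hcon x y _ _ t1 t2 (fun z => f z - g z - c)
    ((hf.1.measurable.sub hg.1.measurable).sub measurable_const) M hM0 hc
  have i1 := hM.isProbabilityMeasure_tilted t1
  have i2 := hM.isProbabilityMeasure_tilted t2
  have hdom : ∀ x, Dominated (fun w => 1 + a₁ w + a₂ w) (fun w => f (G x w) - g (G x w)) := by
    intro x
    obtain ⟨hfc, C, hC⟩ := hf
    obtain ⟨hgc, C', hC'⟩ := hg
    exact (hM.dominated_comp hfc.measurable hC x).sub (hM.dominated_comp hgc.measurable hC' x)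
  rw [integral_sub (hM.envelope.integrable_tilted (hM.dominated_of_isTilt t1) (hdom x))
    (integrable_const c), integral_sub (hM.envelope.integrable_tilted
    (hM.dominated_of_isTilt t2) (hdom y)) (integrable_const c)] at h5
  simp only [integral_const, probReal_univ, smul_eq_mul, one_mul] at h5
  have h6 : ∫ w, (g (G y w) - f (G y w)) ∂(ρ.tilted fun w => γ * (F y h' w + f (G y w))) =
      -∫ w, (f (G y w) - g (G y w)) ∂(ρ.tilted fun w => γ * (F y h' w + f (G y w))) := by
    rw [← integral_neg]; simp only [neg_sub]
  simp only
  linarith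

end Contraction

/-! ### Existence and uniqueness for the Bellman equation. -/

section BellmanEquation

lemma growsLinearly_zero {X : Type*} [TopologicalSpace X] {ω : X → ℝ} : GrowsLinearly ω fun _ => 0 :=
  ⟨continuous_const, 0, fun x => by simp⟩

lemma OscBound.abs_le {X : Type*} {ω : X → ℝ} {β M : ℝ} {φ : X → ℝ} (h : OscBound ω β M φ) (x y : X) :
    |φ x - φ y| ≤ M * (2 + β * ω x + β * ω y) := by
  rw [_root_.abs_le]
  constructor <;> linarith [h x y, h y x]

lemma OscBound.abs_le_of_eq_zero {X : Type*} {ω : X → ℝ} {β M : ℝ} {φ : X → ℝ} (h : OscBound ω β M φ) (hM : 0 ≤ M)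
    (hβ : β ≤ 1) (hω : ∀ x, 0 ≤ ω x) {x₀ : X} (h0 : φ x₀ = 0) (x : X) :
    |φ x| ≤ M * (2 + ω x₀) * (1 + ω x) := by
  have h1 := h.abs_le x x₀
  rw [h0, sub_zero] at h1
  refine h1.trans ?_
  rw [mul_assoc]
  refine mul_le_mul_of_nonneg_left ?_ hM
  have h2 := hω x
  have h3 := hω x₀
  have h4 := mul_le_mul_of_nonneg_right hβ h2
  have h5 := mul_le_mul_of_nonneg_right hβ h3
  have h6 := mul_nonneg h3 h2
  linarith

/-- Convexity of the cumulant function, which vanishes at `0`: the two Gibbs inequalities at the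
tilt `p Z`, weighted by `p` and `1 - p`, add up to the claim. -/
lemma IsExpEnvelope.log_integral_exp_mul_le {S : Type*} [MeasurableSpace S] {ρ : Measure S}
    [IsProbabilityMeasure ρ] {s Z : S → ℝ} (hs : IsExpEnvelope ρ s) (hZ : Dominated s Z) {p : ℝ}
    (hp : 0 < p) (hp1 : p ≤ 1) :
    Real.log (∫ w, Real.exp (p * Z w) ∂ρ) ≤ p * Real.log (∫ w, Real.exp (Z w) ∂ρ) := by
  have hpZ := hZ.const_mul p
  have h1 := hs.integral_tilted_sub_le hZ hpZ
  have h2 := hs.integral_tilted_sub_le (hs.dominated_const 0) hpZ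
  simp only [zero_sub, Real.exp_zero, integral_const, probReal_univ, smul_eq_mul, one_mul,
    Real.log_one] at h2
  rw [integral_neg, integral_const_mul] at h2
  have h3 : ∫ w, (Z w - p * Z w) ∂(ρ.tilted fun w => p * Z w) =
      (1 - p) * ∫ w, Z w ∂(ρ.tilted fun w => p * Z w) := by
    rw [← integral_const_mul]; congr 1 with w; ring
  rw [h3] at h1
  have h4 := mul_le_mul_of_nonneg_left h1 hp.le
  have h5 := mul_le_mul_of_nonneg_left h2 (sub_nonneg.mpr hp1)
  linarith

variable {X A S : Type*} [TopologicalSpace X] [MeasurableSpace X] [BorelSpace X]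
  [TopologicalSpace A] [MeasurableSpace A] [MeasurableSpace S]
  {ρ : Measure S} {G : X → S → X} {F : X → A → S → ℝ} {ω : X → ℝ}
  {a₁ a₂ : S → ℝ} {b₁ b₂ : ℝ} [IsProbabilityMeasure ρ]

variable [FirstCountableTopology X] [FirstCountableTopology A] [CompactSpace A] [Nonempty A]

/-- Jensen gives the upper bound; for the lower one, `|γ| ≤ 1` compares the exponential mean of
order `|γ|` with that of order one. Hence `K` does not depend on `γ`, as the later choice of `γ₀`
requires. -/
lemma IsModel.exists_bellman_zero_le (hM : IsModel ρ G F ω a₁ a₂ b₁ b₂) :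
    ∃ K : ℝ, 0 ≤ K ∧ ∀ γ, γ < 0 → |γ| ≤ 1 → ∀ x,
      |bellman ρ G F γ (fun _ => 0) x| ≤ K + b₂ * ω x := by
  have hE := hM.envelope
  have hda : Dominated (fun w => 1 + a₁ w + a₂ w) a₂ :=
    ⟨hM.measurable_a₂, 1, fun w => by
      rw [abs_of_nonneg (hM.a₂_nonneg w)]; linarith [hM.a₁_nonneg w]⟩
  set K := Real.log (∫ w, Real.exp (a₂ w) ∂ρ) with hK
  have hK1 := hE.integral_le_log hda
  refine ⟨K, (integral_nonneg hM.a₂_nonneg).trans hK1, fun γ hγ hγ1 x => ?_⟩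
  obtain ⟨h, hh⟩ := hM.exists_bellman_eq (γ := γ) growsLinearly_zero x
  rw [hh]
  have hZ := hM.dominated_exponent γ growsLinearly_zero x h
  have hF : Dominated (fun w => 1 + a₁ w + a₂ w) (F x h) :=
    hM.dominated_of_le (D := 1) (c := b₂ * ω x) (hM.measurable_F_right x h) fun w => by
      linarith [hM.growth_F x h w, hM.a₁_nonneg w]
  simp only [util, add_zero] at hZ ⊢
  have hγ' : 0 < -γ := by linarith
  rw [abs_of_neg hγ] at hγ1
  rw [_root_.abs_le, one_div, ← div_eq_inv_mul]
  constructor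
  · rw [le_div_iff_of_neg hγ]
    have h1 := hE.log_mono hZ ((hda.const_mul (-γ)).add (hE.dominated_const (-γ * (b₂ * ω x))))
      fun w => by
        have := mul_le_mul_of_nonneg_left
          ((neg_abs_le (F x h w)).trans' (neg_le_neg (hM.growth_F x h w))) hγ'.le
        linarith
    rw [hE.log_add_const (hda.const_mul (-γ))] at h1
    have h2 := hE.log_integral_exp_mul_le hda hγ' hγ1
    linarith
  · rw [div_le_iff_of_neg hγ]
    have h1 := hE.integral_le_log hZ
    rw [integral_const_mul] at h1
    have h2 : ∫ w, F x h w ∂ρ ≤ ∫ w, (a₂ w + b₂ * ω x) ∂ρ :=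
      integral_mono (hE.integrable_of hF) ((hE.integrable_of hda).add (integrable_const _))
        fun w => (le_abs_self _).trans (hM.growth_F x h w)
    rw [integral_add (hE.integrable_of hda) (integrable_const _)] at h2
    simp only [integral_const, probReal_univ, smul_eq_mul, one_mul] at h2
    have h3 := mul_le_mul_of_nonneg_left (h2.trans (add_le_add_left hK1 _)) hγ'.le
    linarith

/-- Relative value iteration, normalized at `x₀`. -/
noncomputable def valueIteration (ρ : Measure S) (G : X → S → X) (F : X → A → S → ℝ) (γ : ℝ)
    (x₀ : X) : ℕ → X → ℝ
  | 0 => fun _ => 0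
  | n + 1 => fun x => bellman ρ G F γ (valueIteration ρ G F γ x₀ n) x -
      bellman ρ G F γ (valueIteration ρ G F γ x₀ n) x₀

/-- Solvability of the Bellman equation for risk parameters close to zero. -/
theorem IsModel.exists_bellman_solution [Nonempty X] (hM : IsModel ρ G F ω a₁ a₂ b₁ b₂)
    (hN : IsLocallyMinorized ρ G ω) :
    ∃ γ₀ : ℝ, γ₀ < 0 ∧ ∀ γ, γ₀ < γ → γ < 0 → ∃ (v : X → ℝ) (lam : ℝ), GrowsLinearly ω v ∧
      ∀ x, v x + lam = bellman ρ G F γ v x := by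
  obtain ⟨x₀⟩ := ‹Nonempty X›
  have : Nonempty X := ⟨x₀⟩
  obtain ⟨β, L, hβ, hβ1, hL, hL1, hcon⟩ := hM.exists_bellman_contraction hN zero_le_one
  obtain ⟨K, hK, hT0⟩ := hM.exists_bellman_zero_le
  have hω := hM.ω_nonneg
  have hb₂ := hM.b₂_pos
  have hL' : 0 < 1 - L := sub_pos.mpr hL1
  set K₀ := K + b₂ / β with hK₀
  have hK₀pos : 0 < K₀ := by positivity
  -- The fixed point of `M ↦ L M + K₀`, so the oscillation ball of radius `M` is invariant.
  set M := K₀ / (1 - L) with hMdef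
  have hMpos : 0 < M := by positivity
  have hMeq : L * M + K₀ = M := by rw [hMdef]; field_simp; ring
  have hω0 := hω x₀
  set c₀ := M * (2 + ω x₀) with hc₀
  have hc₀pos : 0 < c₀ := by positivity
  -- `c₀` bounds functions in the ball that vanish at `x₀`. This range of `γ` keeps `|γ| c₀ ≤ 1`, so
  -- the contraction for `D = 1` applies to every iterate.
  refine ⟨-min 1 (1 / c₀), by simp [hc₀pos], fun γ hγ0 hγ => ?_⟩
  have hγ1 : |γ| ≤ 1 := by rw [abs_of_neg hγ]; linarith [min_le_left 1 (1 / c₀)]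
  have hγc : |γ| * c₀ ≤ 1 := by
    rw [← le_div_iff₀ hc₀pos, abs_of_neg hγ]; linarith [min_le_right 1 (1 / c₀)]
  have hosc0 : OscBound ω β K₀ (bellman ρ G F γ fun _ => 0) := by
    intro x y
    have h1 := (abs_le.mp (hT0 γ hγ hγ1 x)).2
    have h2 := (abs_le.mp (hT0 γ hγ hγ1 y)).1
    have h3 : K₀ * (2 + β * ω x + β * ω y) =
        2 * K + K * β * (ω x + ω y) + 2 * (b₂ / β) + b₂ * (ω x + ω y) := by
      rw [hK₀]; field_simp; ring
    have h4 : 0 ≤ K * β * (ω x + ω y) :=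
      mul_nonneg (by positivity) (add_nonneg (hω x) (hω y))
    have h5 : 0 ≤ b₂ / β := by positivity
    linarith
  have hsize : ∀ f : X → ℝ, (∀ x, |f x| ≤ c₀ * (1 + ω x)) → ∀ x, |γ * f x| ≤ 1 * (1 + ω x) := by
    intro f hf x
    rw [abs_mul]
    calc |γ| * |f x| ≤ |γ| * (c₀ * (1 + ω x)) := mul_le_mul_of_nonneg_left (hf x) (abs_nonneg _)
      _ = |γ| * c₀ * (1 + ω x) := by ring
      _ ≤ _ := mul_le_mul_of_nonneg_right hγc (by linarith [hω x])
  set f := valueIteration ρ G F γ x₀ with hf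
  have hf0 : ∀ n, f n x₀ = 0 := by
    intro n; cases n <;> simp [hf, valueIteration]
  have hfs : ∀ n x, f (n + 1) x = bellman ρ G F γ (f n) x - bellman ρ G F γ (f n) x₀ :=
    fun n x => rfl
  have hinv : ∀ n, Continuous (f n) ∧ OscBound ω β M (f n) := by
    intro n
    induction n with
    | zero =>
      refine ⟨continuous_const, fun x y => ?_⟩
      have := hω x
      have := hω y
      show (0 : ℝ) - 0 ≤ _
      rw [sub_zero]
      positivity
    | succ n ih =>
      obtain ⟨hc, ho⟩ := ih
      have hb := ho.abs_le_of_eq_zero hMpos.le hβ1 hω (hf0 n)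
      have hg : GrowsLinearly ω (f n) := ⟨hc, c₀, hb⟩
      refine ⟨(hM.continuous_bellman hg).sub continuous_const, fun x y => ?_⟩
      have h1 := hcon γ hγ hγ1 (f n) (fun _ => 0) hg growsLinearly_zero (hsize _ hb)
        (fun x => by simpa using (by linarith [hω x] : 0 ≤ 1 + ω x)) M hMpos.le
        (fun x y => by simpa using ho x y) x y
      have h2 := hosc0 x y
      simp only at h1
      rw [hfs, hfs]
      calc _ ≤ (L * M + K₀) * (2 + β * ω x + β * ω y) := by linarith
        _ = _ := by rw [hMeq]
  have hbd : ∀ n x, |f n x| ≤ c₀ * (1 + ω x) := fun n =>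
    (hinv n).2.abs_le_of_eq_zero hMpos.le hβ1 hω (hf0 n)
  have hgl : ∀ n, GrowsLinearly ω (f n) := fun n => ⟨(hinv n).1, c₀, hbd n⟩
  -- The normalizing constants are invisible to the oscillation, so the increments contract as for
  -- the plain operator.
  have hstep : ∀ n, OscBound ω β (M * L ^ n) (fun x => f (n + 1) x - f n x) := by
    intro n
    induction n with
    | zero =>
      intro x y
      have := (hinv 1).2 x y
      simpa [hf, valueIteration] using this
    | succ n ih =>
      intro x y
      have := hcon γ hγ hγ1 _ _ (hgl (n + 1)) (hgl n) (hsize _ (hbd _)) (hsize _ (hbd _)) _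
        (by positivity) ih x y
      simp only at this ⊢
      rw [hfs (n + 1), hfs n, hfs (n + 1) y, hfs n y]
      calc _ ≤ L * (M * L ^ n) * (2 + β * ω x + β * ω y) := by linarith
        _ = _ := by ring
  have hdist : ∀ x n, dist (f n x) (f (n + 1) x) ≤ M * (2 + β * ω x + β * ω x₀) * L ^ n := by
    intro x n
    have := (hstep n).abs_le x x₀
    simp only [hf0, sub_zero] at this
    rw [dist_comm, Real.dist_eq]
    calc _ ≤ _ := this
      _ = _ := by ring
  choose v hv using fun x => cauchySeq_tendsto_of_complete
    (cauchySeq_of_le_geometric L _ hL1 (hdist x))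
  have hvd : ∀ n x, |v x - f n x| ≤ M / (1 - L) * L ^ n * (2 + β * ω x + β * ω x₀) := by
    intro n x
    have := dist_le_of_le_geometric_of_tendsto L _ hL1 (hdist x) (hv x) n
    rw [dist_comm, Real.dist_eq] at this
    calc _ ≤ _ := this
      _ = _ := by ring
  have hLn : Tendsto (fun n : ℕ => L ^ n) atTop (nhds 0) :=
    tendsto_pow_atTop_nhds_zero_of_lt_one hL.le hL1
  have hvc : Continuous v := by
    refine TendstoLocallyUniformly.continuous (F := f) (p := atTop) ?_
      (Frequently.of_forall fun n => (hinv n).1)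
    rw [Metric.tendstoLocallyUniformly_iff]
    intro ε hε x
    refine ⟨{y | ω y < ω x + 1}, hM.continuous_ω.continuousAt.eventually_lt continuousAt_const
      (lt_add_one _), ?_⟩
    have hlim : Tendsto (fun n : ℕ => M / (1 - L) * L ^ n * (2 + β * (ω x + 1) + β * ω x₀)) atTop
        (nhds 0) := by
      simpa using (hLn.const_mul (M / (1 - L))).mul_const (2 + β * (ω x + 1) + β * ω x₀)
    filter_upwards [hlim.eventually_lt_const hε] with n hn y hy
    rw [Real.dist_eq]
    refine (hvd n y).trans_lt (lt_of_le_of_lt ?_ hn)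
    refine mul_le_mul_of_nonneg_left ?_ (by positivity)
    have := mul_le_mul_of_nonneg_left (show ω y < ω x + 1 from hy).le hβ.le
    linarith
  have hvb : ∀ x, |v x| ≤ c₀ * (1 + ω x) := fun x =>
    le_of_tendsto (hv x).abs (Eventually.of_forall fun n => hbd n x)
  have hvg : GrowsLinearly ω v := ⟨hvc, c₀, hvb⟩
  -- The constant is forced by the normalization of the iterates to vanish at `x₀`.
  refine ⟨v, bellman ρ G F γ v x₀, hvg, fun x => ?_⟩
  have hoscv : ∀ n, OscBound ω β (M / (1 - L) * L ^ n * (2 + β * ω x₀)) fun x => v x - f n x := by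
    intro n x y
    have h1 := (abs_le.mp (hvd n x)).2
    have h2 := (abs_le.mp (hvd n y)).1
    have h3 : 0 ≤ M / (1 - L) * L ^ n := by positivity
    have hx := mul_nonneg hβ.le (hω x)
    have hy := mul_nonneg hβ.le (hω y)
    have h0 := mul_nonneg hβ.le (hω x₀)
    have h4 : (2 + β * ω x + β * ω x₀) + (2 + β * ω y + β * ω x₀) ≤
        (2 + β * ω x₀) * (2 + β * ω x + β * ω y) := by
      linarith [mul_nonneg h0 hx, mul_nonneg h0 hy]
    have h5 := mul_le_mul_of_nonneg_left h4 h3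
    simp only
    linarith
  have hT : ∀ n, |bellman ρ G F γ v x - bellman ρ G F γ v x₀ - f (n + 1) x| ≤
      L * (M / (1 - L) * L ^ n * (2 + β * ω x₀)) * (2 + β * ω x + β * ω x₀) := by
    intro n
    have := (hcon γ hγ hγ1 v (f n) hvg (hgl n) (hsize v hvb) (hsize _ (hbd n)) _
      (by positivity) (hoscv n)).abs_le x x₀
    rw [hfs]
    convert this using 2
    ring
  have hlim2 : Tendsto (fun n : ℕ => L * (M / (1 - L) * L ^ n * (2 + β * ω x₀)) *
      (2 + β * ω x + β * ω x₀)) atTop (nhds 0) := by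
    simpa using (((hLn.const_mul (M / (1 - L))).mul_const (2 + β * ω x₀)).const_mul L).mul_const
      (2 + β * ω x + β * ω x₀)
  have hlim3 : Tendsto (fun n => |bellman ρ G F γ v x - bellman ρ G F γ v x₀ - f (n + 1) x|) atTop
      (nhds |bellman ρ G F γ v x - bellman ρ G F γ v x₀ - v x|) :=
    (tendsto_const_nhds.sub ((hv x).comp (tendsto_add_atTop_nat 1))).abs
  have h0 := le_of_tendsto_of_tendsto' hlim3 hlim2 hT
  have := abs_nonpos_iff.mp h0
  linarith

/-- Uniqueness of the solution of the Bellman equation. -/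
theorem IsModel.bellman_solution_unique [Nonempty X] (hM : IsModel ρ G F ω a₁ a₂ b₁ b₂)
    (hN : IsLocallyMinorized ρ G ω) {γ : ℝ} (hγ : γ < 0) {v v' : X → ℝ} {lam lam' : ℝ}
    (hv : GrowsLinearly ω v) (hv' : GrowsLinearly ω v')
    (h : ∀ x, v x + lam = bellman ρ G F γ v x) (h' : ∀ x, v' x + lam' = bellman ρ G F γ v' x) :
    lam' = lam ∧ ∃ c : ℝ, ∀ x, v' x = v x + c := by
  obtain ⟨x₀⟩ := ‹Nonempty X›
  have : Nonempty X := ⟨x₀⟩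
  obtain ⟨-, C, hC⟩ := id hv
  obtain ⟨-, C', hC'⟩ := id hv'
  have hω := hM.ω_nonneg
  set B := |C| + |C'| with hB
  have hB0 : 0 ≤ B := by positivity
  have hvB : ∀ x, |v x| ≤ B * (1 + ω x) := fun x => (hC x).trans
    (mul_le_mul_of_nonneg_right (by linarith [le_abs_self C, abs_nonneg C']) (by linarith [hω x]))
  have hvB' : ∀ x, |v' x| ≤ B * (1 + ω x) := fun x => (hC' x).trans
    (mul_le_mul_of_nonneg_right (by linarith [le_abs_self C', abs_nonneg C]) (by linarith [hω x]))
  have hsize : ∀ f : X → ℝ, (∀ x, |f x| ≤ B * (1 + ω x)) → ∀ x,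
      |γ * f x| ≤ |γ| * (1 + B) * (1 + ω x) := by
    intro f hf x
    rw [abs_mul, mul_assoc]
    refine mul_le_mul_of_nonneg_left ((hf x).trans ?_) (abs_nonneg γ)
    exact mul_le_mul_of_nonneg_right (by linarith) (by linarith [hω x])
  -- Here `D` is adapted to both given solutions, so `γ < 0` is arbitrary.
  obtain ⟨β, L, hβ, hβ1, hL, hL1, hcon⟩ := hM.exists_bellman_contraction hN
    (D := |γ| * (1 + B)) (by positivity)
  have hγD : |γ| ≤ |γ| * (1 + B) := le_mul_of_one_le_right (abs_nonneg γ) (by linarith)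
  set M := 2 * B / β with hMdef
  have hM0 : 0 ≤ M := by positivity
  -- By the equation, applying the Bellman operator changes `v - v'` only by a constant, so its
  -- oscillation bound can be multiplied by `L` indefinitely.
  have hosc : ∀ n : ℕ, OscBound ω β (L ^ n * M) fun x => v x - v' x := by
    intro n
    induction n with
    | zero =>
      intro x y
      have h1 := (abs_le.mp (hvB x)).2
      have h2 := (abs_le.mp (hvB y)).1
      have h3 := (abs_le.mp (hvB' x)).1
      have h4 := (abs_le.mp (hvB' y)).2
      have h5 : M * (2 + β * ω x + β * ω y) = 2 * B * (ω x + ω y) + 4 * B / β := by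
        rw [hMdef]; field_simp; ring
      have h6 : 4 * B ≤ 4 * B / β := le_div_self (by positivity) hβ hβ1
      simp only [pow_zero, one_mul]
      linarith
    | succ n ih =>
      intro x y
      have := hcon γ hγ hγD v v' hv hv' (hsize v hvB) (hsize v' hvB') _ (by positivity) ih x y
      simp only [← h, ← h'] at this
      simp only
      calc _ ≤ L * (L ^ n * M) * (2 + β * ω x + β * ω y) := by linarith
        _ = _ := by ring
  have hconst : ∀ x, v' x = v x + (v' x₀ - v x₀) := by
    intro x
    have hlim : Tendsto (fun n : ℕ => L ^ n * M * (2 + β * ω x + β * ω x₀)) atTop (nhds 0) := by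
      simpa using ((tendsto_pow_atTop_nhds_zero_of_lt_one hL.le hL1).mul_const M).mul_const
        (2 + β * ω x + β * ω x₀)
    have := ge_of_tendsto' hlim fun n => (hosc n).abs_le x x₀
    linarith [abs_nonpos_iff.mp this]
  refine ⟨?_, _, hconst⟩
  set c := v' x₀ - v x₀
  have hb : bellman ρ G F γ v' x₀ = bellman ρ G F γ v x₀ + c := by
    have hu : ∀ z, util ρ G F γ v' x₀ z = util ρ G F γ v x₀ z + c := fun z => by
      rw [← hM.util_add_const hγ hv c x₀ z]; congr 1; exact funext hconst
    obtain ⟨z, hz⟩ := hM.exists_bellman_eq (γ := γ) hv x₀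
    obtain ⟨z', hz'⟩ := hM.exists_bellman_eq (γ := γ) hv' x₀
    have h1 := hM.util_le_bellman (γ := γ) hv' x₀ z
    have h2 := hM.util_le_bellman (γ := γ) hv x₀ z'
    rw [hu] at h1 hz'
    linarith
  linarith [h x₀, h' x₀, hconst x₀]

end BellmanEquation

/-! ### Borel selection of maximizers. -/

section Selection

variable {X A : Type*}

/-- The minimizers of `q` in `Γ x`. -/
def argminOn (Γ : X → Set A) (q : A → ℝ) (x : X) : Set A :=
  {a | a ∈ Γ x ∧ ∀ b ∈ Γ x, q a ≤ q b}

/-- Successive minimization of `q 0, q 1, …` on `Γ`. -/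
def lexArgmin (Γ : X → Set A) (q : ℕ → A → ℝ) : ℕ → X → Set A
  | 0 => Γ
  | n + 1 => argminOn (lexArgmin Γ q n) (q n)

lemma lexArgmin_subset (Γ : X → Set A) (q : ℕ → A → ℝ) (n : ℕ) (x : X) :
    lexArgmin Γ q n x ⊆ Γ x := by
  induction n with
  | zero => exact subset_rfl
  | succ n ih => exact fun a ha => ih ha.1

lemma eq_of_mem_lexArgmin {Γ : X → Set A} {q : ℕ → A → ℝ} {n : ℕ} {x : X} {a b : A}
    (ha : a ∈ lexArgmin Γ q n x) (hb : b ∈ lexArgmin Γ q n x) : ∀ i < n, q i a = q i b := by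
  induction n with
  | zero => simp
  | succ n ih =>
    intro i hi
    rcases Nat.lt_succ_iff_lt_or_eq.mp hi with h | rfl
    · exact ih ha.1 hb.1 i h
    · exact le_antisymm (ha.2 b hb.1) (hb.2 a ha.1)

variable [MeasurableSpace X] [TopologicalSpace A]

/-- A closed- and nonempty-valued correspondence that is measurable with respect to closed sets. -/
structure IsMeasurableCorrespondence (Γ : X → Set A) : Prop where
  isClosed : ∀ x, IsClosed (Γ x)
  nonempty : ∀ x, (Γ x).Nonempty
  measurable : ∀ K, IsClosed K → MeasurableSet {x | (Γ x ∩ K).Nonempty}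

/-- The minimizers meet `K` exactly when the minima of `q` over `Γ x ∩ K` and over `Γ x` agree;
comparing both with all rational levels makes this a countable condition. -/
lemma IsMeasurableCorrespondence.argminOn [CompactSpace A] {Γ : X → Set A}
    (hΓ : IsMeasurableCorrespondence Γ) {q : A → ℝ} (hq : Continuous q) :
    IsMeasurableCorrespondence (argminOn Γ q) where
  isClosed x := by
    have : RSC.argminOn Γ q x = Γ x ∩ ⋂ b ∈ Γ x, {a | q a ≤ q b} := by
      ext a; simp [RSC.argminOn]
    rw [this]
    exact (hΓ.isClosed x).inter
      (isClosed_biInter fun b _ => isClosed_le hq continuous_const)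
  nonempty x := by
    obtain ⟨a, ha, hmin⟩ := (hΓ.isClosed x).isCompact.exists_isMinOn (hΓ.nonempty x) hq.continuousOn
    exact ⟨a, ha, fun b hb => hmin hb⟩
  measurable K hK := by
    have hset : {x | (RSC.argminOn Γ q x ∩ K).Nonempty} = {x | (Γ x ∩ K).Nonempty} ∩
        ⋂ r : ℚ, ({x | (Γ x ∩ {a | q a ≤ r}).Nonempty}ᶜ ∪
          {x | (Γ x ∩ (K ∩ {a | q a ≤ r})).Nonempty}) := by
      ext x
      simp only [Set.mem_inter_iff, Set.mem_iInter, Set.mem_union, Set.mem_compl_iff]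
      constructor
      · rintro ⟨a, ⟨ha, hmin⟩, haK⟩
        refine ⟨⟨a, ha, haK⟩, fun r => ?_⟩
        by_cases h : (Γ x ∩ {a | q a ≤ r}).Nonempty
        · obtain ⟨b, hb, hbr⟩ := h
          exact Or.inr ⟨a, ha, haK, (hmin b hb).trans hbr⟩
        · exact Or.inl h
      · rintro ⟨hne, hr⟩
        obtain ⟨a, ⟨ha, haK⟩, hmin⟩ := ((hΓ.isClosed x).inter hK).isCompact.exists_isMinOn hne
          hq.continuousOn
        refine ⟨a, ⟨ha, fun b hb => ?_⟩, haK⟩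
        by_contra! hlt
        obtain ⟨r, hr1, hr2⟩ := exists_rat_btwn hlt
        rcases hr r with h | h
        · exact h ⟨b, hb, hr1.le⟩
        · obtain ⟨c, hc, hcK, hcr⟩ := h
          have h1 : q a ≤ q c := hmin ⟨hc, hcK⟩
          have h2 : q c ≤ r := hcr
          linarith
    rw [hset]
    have hle : ∀ r : ℚ, IsClosed {a | q a ≤ r} := fun r => isClosed_le hq continuous_const
    exact (hΓ.measurable K hK).inter (MeasurableSet.iInter fun r =>
      (hΓ.measurable _ (hle r)).compl.union (hΓ.measurable _ (hK.inter (hle r))))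

lemma isMeasurableCorrespondence_lexArgmin [CompactSpace A] {Γ : X → Set A}
    (hΓ : IsMeasurableCorrespondence Γ) {q : ℕ → A → ℝ} (hq : ∀ i, Continuous (q i)) (n : ℕ) :
    IsMeasurableCorrespondence (lexArgmin Γ q n) := by
  induction n with
  | zero => exact hΓ
  | succ n ih => exact ih.argminOn (hq n)

/-- A jointly continuous function on `X × A` has a Borel selector of maximizers if finitely many
continuous functions separate the points of the compact space `A`. -/
theorem exists_measurable_argmax [TopologicalSpace X] [BorelSpace X] [CompactSpace A] [Nonempty A]
    [MeasurableSpace A] [BorelSpace A] {q : ℕ → A → ℝ} (hq : ∀ i, Continuous (q i)) {n : ℕ}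
    (hsep : ∀ a b, (∀ i < n, q i a = q i b) → a = b) {u : X → A → ℝ}
    (hu : Continuous fun p : X × A => u p.1 p.2) :
    ∃ η : X → A, Measurable η ∧ ∀ x a, u x a ≤ u x (η x) := by
  have hΓ : IsMeasurableCorrespondence fun x => {a | ∀ b, u x b ≤ u x a} := by
    refine ⟨fun x => ?_, fun x => ?_, fun K hK => IsClosed.measurableSet ?_⟩
    · have h1 := hu.comp (Continuous.prodMk_right x)
      have : {a | ∀ b, u x b ≤ u x a} = ⋂ b, {a | u x b ≤ u x a} := by ext; simp
      rw [this]
      exact isClosed_iInter fun b => isClosed_le continuous_const h1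
    · obtain ⟨a, -, ha⟩ := isCompact_univ.exists_isMaxOn Set.univ_nonempty
        (hu.comp (Continuous.prodMk_right x)).continuousOn
      exact ⟨a, fun b => ha (Set.mem_univ b)⟩
    -- Projection along the compact space `A` is a closed map, so the states whose maximizers meet
    -- `K` form a closed set.
    · have hcl : IsClosed {p : X × A | p.2 ∈ K ∧ ∀ b, u p.1 b ≤ u p.1 p.2} := by
        have : {p : X × A | p.2 ∈ K ∧ ∀ b, u p.1 b ≤ u p.1 p.2} =
            Prod.snd ⁻¹' K ∩ ⋂ b, {p : X × A | u p.1 b ≤ u p.1 p.2} := by ext; simp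
        rw [this]
        refine (hK.preimage continuous_snd).inter (isClosed_iInter fun b => isClosed_le ?_ hu)
        exact hu.comp (continuous_fst.prodMk continuous_const)
      have := isClosedMap_fst_of_compactSpace _ hcl
      convert this using 1
      ext x
      constructor
      · rintro ⟨a, ha, haK⟩
        exact ⟨(x, a), ⟨haK, ha⟩, rfl⟩
      · rintro ⟨⟨y, a⟩, ⟨haK, ha⟩, rfl⟩
        exact ⟨a, ha, haK⟩
  have hL := isMeasurableCorrespondence_lexArgmin hΓ hq n
  -- Any choice will do: minimizing `n` separating functions leaves a single point, so the preimage
  -- of `K` is the set of states whose correspondence meets `K`.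
  choose η hη using hL.nonempty
  refine ⟨η, measurable_of_isClosed fun K hK => ?_, fun x a =>
    lexArgmin_subset _ q n x (hη x) a⟩
  convert hL.measurable K hK using 1
  ext x
  constructor
  · exact fun h => ⟨η x, hη x, h⟩
  · rintro ⟨a, ha, haK⟩
    have := hsep _ _ (eq_of_mem_lexArgmin ha (hη x))
    show η x ∈ K
    rwa [← this]

end Selection

/-! ### From the probabilistic hypotheses and extended-real utilities to the analytic model. -/

section Bridge

variable {Ω : Type*} [MeasurableSpace Ω] {P : Measure Ω} {k m n : ℕ}
  {U : Set (Vec m)} {W : ℕ → Ω → Vec n} {G : Vec k → Vec n → Vec k} {F : Vec k → U → Vec n → ℝ}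
  {ω : Vec k → ℝ} {a₁ a₂ : Vec n → ℝ} {b₁ b₂ γ : ℝ}

lemma lintegral_ofReal_exp_ne_top_of_utility {Z : Ω → ℝ} {κ r : ℝ} (hκ : 0 < κ)
    (h : entropicUtility P κ Z = (r : EReal)) :
    ∫⁻ o, ENNReal.ofReal (Real.exp (κ * Z o)) ∂P ≠ ⊤ := by
  intro htop
  rw [entropicUtility, if_neg hκ.ne', htop, ENNReal.log_top,
    EReal.coe_mul_top_of_pos (by positivity)] at h
  exact EReal.top_ne_coe r h

lemma integrable_exp_of_utility {a : Vec n → ℝ} (hW : Measurable (W 0)) (ha : Measurable a)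
    (h : ∀ γ : ℝ, ∃ r : ℝ, entropicUtility P γ (fun o => a (W 0 o)) = (r : EReal)) {κ : ℝ}
    (hκ : 0 < κ) : Integrable (fun w => Real.exp (κ * a w)) (P.map (W 0)) := by
  obtain ⟨r, hr⟩ := h κ
  have hm : Measurable fun w => Real.exp (κ * a w) := (ha.const_mul κ).exp
  refine ⟨hm.aestronglyMeasurable, ?_⟩
  rw [hasFiniteIntegral_iff_ofReal (ae_of_all _ fun w => (Real.exp_pos _).le),
    lintegral_map hm.ennreal_ofReal hW]
  exact (lintegral_ofReal_exp_ne_top_of_utility hκ hr).lt_top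

lemma isModel_of [IsProbabilityMeasure P] (hA1 : IsIIDNoise P W) (hA2 : IsFactorMap G)
    (hA3 : IsLogReturnMap F) (hA4 : HasWeightedGrowth P W G F ω a₁ a₂ b₁ b₂) :
    IsModel (P.map (W 0)) G F ω a₁ a₂ b₁ b₂ where
  measurable_G := hA2.measurable
  continuous_G := hA2.continuous
  measurable_F := hA3.measurable
  continuous_F := hA3.continuous
  continuous_ω := hA4.weight_continuous
  ω_nonneg := hA4.weight_nonneg
  a₁_nonneg := hA4.a₁_nonneg
  a₂_nonneg := hA4.a₂_nonneg
  measurable_a₁ := hA4.a₁_measurable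
  measurable_a₂ := hA4.a₂_measurable
  b₁_pos := hA4.b₁_pos
  b₁_lt_one := hA4.b₁_lt_one
  b₂_pos := hA4.b₂_pos
  growth_G := hA4.growth_G
  growth_F := hA4.growth_F
  envelope := by
    have hm : Measurable fun w => 1 + a₁ w + a₂ w :=
      (measurable_const.add hA4.a₁_measurable).add hA4.a₂_measurable
    refine ⟨hm, fun w => by linarith [hA4.a₁_nonneg w, hA4.a₂_nonneg w], fun θ => ?_⟩
    -- The factor two allows `a₁ + a₂` to be replaced by twice the larger term; the summand one
    -- keeps the order positive when `θ = 0`.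
    have hκ : 0 < 2 * |θ| + 1 := by positivity
    have h1 := integrable_exp_of_utility (hA1.measurable 0) hA4.a₁_measurable hA4.a₁_utility hκ
    have h2 := integrable_exp_of_utility (hA1.measurable 0) hA4.a₂_measurable hA4.a₂_utility hκ
    refine ((h1.add h2).const_mul (Real.exp |θ|)).mono' (hm.const_mul θ).exp.aestronglyMeasurable
      (ae_of_all _ fun w => ?_)
    rw [Real.norm_eq_abs, Real.abs_exp]
    have p1 := hA4.a₁_nonneg w
    have p2 := hA4.a₂_nonneg w
    have hθ : θ * (1 + a₁ w + a₂ w) ≤ |θ| * (1 + a₁ w + a₂ w) :=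
      mul_le_mul_of_nonneg_right (le_abs_self θ) (by linarith)
    show _ ≤ Real.exp |θ| * (Real.exp ((2 * |θ| + 1) * a₁ w) + Real.exp ((2 * |θ| + 1) * a₂ w))
    rw [mul_add (Real.exp _), ← Real.exp_add, ← Real.exp_add]
    rcases le_total (a₁ w) (a₂ w) with hle | hle
    · refine le_add_of_nonneg_of_le (Real.exp_pos _).le (Real.exp_le_exp.mpr ?_)
      have := mul_le_mul_of_nonneg_left hle (abs_nonneg θ)
      linarith
    · refine le_add_of_le_of_nonneg (Real.exp_le_exp.mpr ?_) (Real.exp_pos _).le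
      have := mul_le_mul_of_nonneg_left hle (abs_nonneg θ)
      linarith

lemma isLocallyMinorized_of (hA1 : IsIIDNoise P W) (hA2 : IsFactorMap G)
    (hA5 : HasLocalMinorization P W G ω) : IsLocallyMinorized (P.map (W 0)) G ω := by
  intro R hR
  obtain ⟨c, hc, ν, hν, h⟩ := hA5 R hR
  refine ⟨c, hc, ν, hν, fun x hx => Measure.le_iff.mpr fun s hs => ?_⟩
  have hG : Measurable (G x) := hA2.measurable.comp (measurable_const.prodMk measurable_id)
  rw [Measure.smul_apply, Measure.map_apply hG hs, Measure.map_apply (hA1.measurable 0) (hG hs)]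
  exact h x hx s hs

lemma memWeighted_iff (hω : ∀ x, 0 ≤ ω x) {f : Vec k → ℝ} :
    MemWeighted ω f ↔ GrowsLinearly ω f := by
  refine and_congr_right fun _ => exists_congr fun C => ?_
  simp only [mem_upperBounds, Set.forall_mem_range]
  exact forall_congr' fun x => div_le_iff₀ (by linarith [hω x])

lemma bellmanUtility_eq [IsProbabilityMeasure P] (hW : Measurable (W 0))
    (hM : IsModel (P.map (W 0)) G F ω a₁ a₂ b₁ b₂) (hγ : γ < 0) {v : Vec k → ℝ}
    (hv : GrowsLinearly ω v) (x : Vec k) (h : U) :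
    bellmanUtility P G F W γ v x h = (util (P.map (W 0)) G F γ v x h : EReal) := by
  have : IsProbabilityMeasure (P.map (W 0)) := Measure.isProbabilityMeasure_map hW.aemeasurable
  have hd := hM.dominated_exponent γ hv x h
  rw [bellmanUtility, entropicUtility, if_neg hγ.ne, util, EReal.coe_mul,
    ← ENNReal.log_ofReal_of_pos (hM.envelope.integral_exp_pos hd),
    ofReal_integral_eq_lintegral_ofReal (hM.envelope.integrable_exp_of hd)
      (ae_of_all _ fun w => (Real.exp_pos _).le), lintegral_map hd.1.exp.ennreal_ofReal hW]

lemma iSup_bellmanUtility [IsProbabilityMeasure P] [CompactSpace U] [Nonempty U]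
    (hW : Measurable (W 0)) (hM : IsModel (P.map (W 0)) G F ω a₁ a₂ b₁ b₂) (hγ : γ < 0)
    {v : Vec k → ℝ} (hv : GrowsLinearly ω v) (x : Vec k) :
    ⨆ h : U, bellmanUtility P G F W γ v x h = (bellman (P.map (W 0)) G F γ v x : EReal) := by
  have : IsProbabilityMeasure (P.map (W 0)) := Measure.isProbabilityMeasure_map hW.aemeasurable
  simp only [bellmanUtility_eq hW hM hγ hv]
  refine le_antisymm (iSup_le fun h => EReal.coe_le_coe (hM.util_le_bellman hv x h)) ?_
  obtain ⟨h, hh⟩ := hM.exists_bellman_eq (γ := γ) hv x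
  rw [hh]
  exact le_iSup (fun h => ((util (P.map (W 0)) G F γ v x h : ℝ) : EReal)) h

lemma isBellmanSolution_iff [IsProbabilityMeasure P] [CompactSpace U] [Nonempty U]
    (hW : Measurable (W 0)) (hM : IsModel (P.map (W 0)) G F ω a₁ a₂ b₁ b₂) (hγ : γ < 0)
    {v : Vec k → ℝ} {lam : ℝ} :
    IsBellmanSolution P G F W ω γ v lam ↔
      GrowsLinearly ω v ∧ ∀ x, v x + lam = bellman (P.map (W 0)) G F γ v x := by
  rw [IsBellmanSolution, memWeighted_iff hM.ω_nonneg]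
  refine and_congr_right fun hv => forall_congr' fun x => ?_
  rw [iSup_bellmanUtility hW hM hγ hv, EReal.coe_eq_coe_iff]

end Bridge

/-! ### Adaptedness and moments of the portfolio value. -/

section Strategies

variable {Ω : Type*} {k m n : ℕ}
  {U : Set (Vec m)} {W : ℕ → Ω → Vec n} {G : Vec k → Vec n → Vec k} {F : Vec k → U → Vec n → ℝ}
  {ω : Vec k → ℝ} {a₁ a₂ : Vec n → ℝ} {b₁ b₂ γ : ℝ} {H : ℕ → Ω → U} {x₀ : Vec k} {V₀ : ℝ}

lemma noiseSigma_mono (W : ℕ → Ω → Vec n) {s t : ℕ} (h : s ≤ t) :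
    noiseSigma W s ≤ noiseSigma W t :=
  iSup_mono fun _ => iSup_mono' fun hr => ⟨lt_of_lt_of_le hr h, le_rfl⟩

lemma measurable_noise (W : ℕ → Ω → Vec n) (t : ℕ) : Measurable[noiseSigma W (t + 1)] (W t) :=
  measurable_iff_comap_le.mpr (le_iSup_of_le t (le_iSup_of_le (Nat.lt_succ_self t) le_rfl))

lemma measurable_factor (hA2 : IsFactorMap G) (W : ℕ → Ω → Vec n) (x₀ : Vec k) (t : ℕ) :
    Measurable[noiseSigma W t] (factor G W x₀ t) := by
  induction t with
  | zero => exact measurable_const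
  | succ t ih =>
    exact hA2.measurable.comp
      ((ih.mono (noiseSigma_mono W t.le_succ) le_rfl).prodMk (measurable_noise W t))

lemma measurable_portfolioValue (hA2 : IsFactorMap G) (hA3 : IsLogReturnMap F)
    (hH : IsAdmissible W H) (x₀ : Vec k) (V₀ : ℝ) (t : ℕ) :
    Measurable[noiseSigma W t] (portfolioValue G F W x₀ V₀ H t) := by
  induction t with
  | zero => exact measurable_const
  | succ t ih =>
    have hle := noiseSigma_mono W t.le_succ
    have h1 : Measurable[noiseSigma W (t + 1)] fun o =>
        F (factor G W x₀ t o) (H t o) (W t o) := hA3.measurable.comp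
      (((measurable_factor hA2 W x₀ t).mono hle le_rfl).prodMk
        (((hH t).mono hle le_rfl).prodMk (measurable_noise W t)))
    exact (ih.mono hle le_rfl).mul h1.exp

lemma isAdmissible_feedback (hA2 : IsFactorMap G) {η : Vec k → U} (hη : Measurable η)
    (x₀ : Vec k) : IsAdmissible W (fun t o => η (factor G W x₀ t o)) :=
  fun t => hη.comp (measurable_factor hA2 W x₀ t)

lemma portfolioValue_pos (hV : 0 < V₀) (t : ℕ) (o : Ω) :
    0 < portfolioValue G F W x₀ V₀ H t o := by
  induction t with
  | zero => exact hV
  | succ t ih => exact mul_pos ih (Real.exp_pos _)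

lemma portfolioValue_succ_rpow (hV : 0 < V₀) (t : ℕ) (o : Ω) :
    portfolioValue G F W x₀ V₀ H (t + 1) o ^ γ = portfolioValue G F W x₀ V₀ H t o ^ γ *
      Real.exp (γ * F (factor G W x₀ t o) (H t o) (W t o)) := by
  rw [portfolioValue, Real.mul_rpow (portfolioValue_pos hV t o).le (Real.exp_pos _).le,
    ← Real.exp_mul, mul_comm γ]

variable [MeasurableSpace Ω] {P : Measure Ω}

lemma noiseSigma_le (hA1 : IsIIDNoise P W) (t : ℕ) : noiseSigma W t ≤ ‹MeasurableSpace Ω› :=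
  iSup_le fun s => iSup_le fun _ => (hA1.measurable s).comap_le

/-- Integrating out the noise `W t`, which is independent of the past. -/
lemma lintegral_noise [IsProbabilityMeasure P] (hA1 : IsIIDNoise P W) {E : Type*}
    [MeasurableSpace E] {t : ℕ} {Y : Ω → E} (hY : Measurable[noiseSigma W t] Y)
    {Φ : E × Vec n → ENNReal} (hΦ : Measurable Φ) :
    ∫⁻ o, Φ (Y o, W t o) ∂P = ∫⁻ o, ∫⁻ w, Φ (Y o, w) ∂(P.map (W 0)) ∂P := by
  have hY' : Measurable Y := hY.mono (noiseSigma_le hA1 t) le_rfl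
  have hWt := hA1.measurable t
  have : IsProbabilityMeasure (P.map (W t)) := Measure.isProbabilityMeasure_map hWt.aemeasurable
  -- `Y` depends on the noise with indices below `t`, and these are disjoint from `{t}`.
  have hind : IndepFun Y (W t) P := by
    have h1 := indep_iSup_of_disjoint (fun s => (hA1.measurable s).comap_le) hA1.indep.iIndep
      (S := Set.Iio t) (T := {t}) (by simp)
    rw [IndepFun_iff_Indep]
    refine indep_of_indep_of_le_left (indep_of_indep_of_le_right h1 ?_)
      (m₃ := MeasurableSpace.comap Y inferInstance) hY.comap_le
    exact le_iSup_of_le t (le_iSup_of_le rfl le_rfl)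
  rw [← lintegral_map hΦ (hY'.prodMk hWt),
    (indepFun_iff_map_prod_eq_prod_map_map hY'.aemeasurable hWt.aemeasurable).mp hind,
    lintegral_prod _ hΦ.aemeasurable, lintegral_map hΦ.lintegral_prod_right' hY',
    (hA1.identDistrib t).map_eq]

/-- Conditioning the weighted power of the portfolio value on the past. -/
lemma lintegral_value_succ [IsProbabilityMeasure P] (hA1 : IsIIDNoise P W) (hA2 : IsFactorMap G)
    (hA3 : IsLogReturnMap F) (hM : IsModel (P.map (W 0)) G F ω a₁ a₂ b₁ b₂) (hγ : γ < 0)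
    (hV : 0 < V₀) (hH : IsAdmissible W H) {v : Vec k → ℝ} (hv : GrowsLinearly ω v) (t : ℕ) :
    ∫⁻ o, ENNReal.ofReal (portfolioValue G F W x₀ V₀ H (t + 1) o ^ γ *
        Real.exp (γ * v (factor G W x₀ (t + 1) o))) ∂P =
      ∫⁻ o, ENNReal.ofReal (portfolioValue G F W x₀ V₀ H t o ^ γ *
        Real.exp (γ * util (P.map (W 0)) G F γ v (factor G W x₀ t o) (H t o))) ∂P := by
  have : IsProbabilityMeasure (P.map (W 0)) :=
    Measure.isProbabilityMeasure_map (hA1.measurable 0).aemeasurable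
  have hvm := hv.1.measurable
  set Y : Ω → ℝ × Vec k × U := fun o =>
    (portfolioValue G F W x₀ V₀ H t o, factor G W x₀ t o, H t o)
  have hY : Measurable[noiseSigma W t] Y :=
    (measurable_portfolioValue hA2 hA3 hH x₀ V₀ t).prodMk
      ((measurable_factor hA2 W x₀ t).prodMk (hH t))
  set Φ : (ℝ × Vec k × U) × Vec n → ENNReal := fun p =>
    ENNReal.ofReal (p.1.1 ^ γ * Real.exp (γ * (F p.1.2.1 p.1.2.2 p.2 + v (G p.1.2.1 p.2)))) with hΦd
  have hΦ : Measurable Φ := by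
    have h1 : Measurable fun p : (ℝ × Vec k × U) × Vec n => F p.1.2.1 p.1.2.2 p.2 :=
      hA3.measurable.comp (by fun_prop :
        Measurable fun p : (ℝ × Vec k × U) × Vec n => (p.1.2.1, p.1.2.2, p.2))
    have h2 : Measurable fun p : (ℝ × Vec k × U) × Vec n => v (G p.1.2.1 p.2) :=
      hvm.comp (hA2.measurable.comp (by fun_prop :
        Measurable fun p : (ℝ × Vec k × U) × Vec n => (p.1.2.1, p.2)))
    exact ((measurable_fst.fst.pow_const γ).mul ((h1.add h2).const_mul γ).exp).ennreal_ofReal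
  have hL : ∀ o, ENNReal.ofReal (portfolioValue G F W x₀ V₀ H (t + 1) o ^ γ *
      Real.exp (γ * v (factor G W x₀ (t + 1) o))) = Φ (Y o, W t o) := by
    intro o
    simp only [hΦd, Y, portfolioValue_succ_rpow hV, factor]
    rw [mul_assoc, ← Real.exp_add, ← mul_add]
  simp only [hL]
  rw [lintegral_noise hA1 hY hΦ]
  refine lintegral_congr fun o => ?_
  have hp : 0 ≤ portfolioValue G F W x₀ V₀ H t o ^ γ :=
    Real.rpow_nonneg (portfolioValue_pos hV t o).le γ
  have hd := hM.dominated_exponent γ hv (factor G W x₀ t o) (H t o)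
  simp only [hΦd, Y, ENNReal.ofReal_mul hp]
  rw [lintegral_const_mul _ hd.1.exp.ennreal_ofReal,
    ← ofReal_integral_eq_lintegral_ofReal (hM.envelope.integrable_exp_of hd)
      (ae_of_all _ fun w => (Real.exp_pos _).le), hM.integral_eq_exp_util hγ hv]

/-- One-step estimate for the `ω`-weighted moments of the portfolio value. -/
lemma lintegral_weight_succ_le [IsProbabilityMeasure P] (hA1 : IsIIDNoise P W)
    (hA2 : IsFactorMap G) (hA3 : IsLogReturnMap F)
    (hM : IsModel (P.map (W 0)) G F ω a₁ a₂ b₁ b₂)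
    (hV : 0 < V₀) (hH : IsAdmissible W H) {θ : ℝ} (hθ : 0 ≤ θ) (t : ℕ) :
    ∫⁻ o, ENNReal.ofReal (portfolioValue G F W x₀ V₀ H (t + 1) o ^ γ *
        Real.exp (θ * ω (factor G W x₀ (t + 1) o))) ∂P ≤
      ENNReal.ofReal (∫ w, Real.exp (θ * a₁ w + |γ| * a₂ w) ∂(P.map (W 0))) *
      ∫⁻ o, ENNReal.ofReal (portfolioValue G F W x₀ V₀ H t o ^ γ *
        Real.exp ((θ * b₁ + |γ| * b₂) * ω (factor G W x₀ t o))) ∂P := by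
  have : IsProbabilityMeasure (P.map (W 0)) :=
    Measure.isProbabilityMeasure_map (hA1.measurable 0).aemeasurable
  have hωm := hM.continuous_ω.measurable
  set Y : Ω → ℝ := fun o => portfolioValue G F W x₀ V₀ H t o ^ γ *
        Real.exp ((θ * b₁ + |γ| * b₂) * ω (factor G W x₀ t o))
  have hY : Measurable[noiseSigma W t] Y :=
    ((measurable_portfolioValue hA2 hA3 hH x₀ V₀ t).pow_const γ).mul
      ((hωm.comp (measurable_factor hA2 W x₀ t)).const_mul _).exp
  have hda : Dominated (fun w => 1 + a₁ w + a₂ w) (fun w => θ * a₁ w + |γ| * a₂ w) :=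
    (hM.dominated_a₁.const_mul θ).add (Dominated.const_mul ⟨hM.measurable_a₂, 1, fun w => by
      rw [abs_of_nonneg (hM.a₂_nonneg w)]; linarith [hM.a₁_nonneg w]⟩ |γ|)
  have hΦ : Measurable fun p : ℝ × Vec n =>
      ENNReal.ofReal p.1 * ENNReal.ofReal (Real.exp (θ * a₁ p.2 + |γ| * a₂ p.2)) :=
    measurable_fst.ennreal_ofReal.mul (hda.1.exp.ennreal_ofReal.comp measurable_snd)
  calc _ ≤ ∫⁻ o, ENNReal.ofReal (Y o) *
        ENNReal.ofReal (Real.exp (θ * a₁ (W t o) + |γ| * a₂ (W t o))) ∂P := by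
        refine lintegral_mono fun o => ?_
        have hp : 0 ≤ portfolioValue G F W x₀ V₀ H t o ^ γ :=
          Real.rpow_nonneg (portfolioValue_pos hV t o).le γ
        rw [← ENNReal.ofReal_mul (mul_nonneg hp (Real.exp_pos _).le)]
        refine ENNReal.ofReal_le_ofReal ?_
        rw [portfolioValue_succ_rpow hV]
        simp only [mul_assoc, ← Real.exp_add]
        refine mul_le_mul_of_nonneg_left (Real.exp_le_exp.mpr ?_) hp
        have h1 : γ * F (factor G W x₀ t o) (H t o) (W t o) ≤
            |γ| * (a₂ (W t o) + b₂ * ω (factor G W x₀ t o)) := by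
          refine (le_abs_self _).trans ?_
          rw [abs_mul]
          exact mul_le_mul_of_nonneg_left (hM.growth_F _ _ _) (abs_nonneg γ)
        have h2 := mul_le_mul_of_nonneg_left (hM.growth_G (factor G W x₀ t o) (W t o)) hθ
        simp only [factor]
        linarith
    _ = _ := by
        rw [lintegral_noise hA1 hY hΦ]
        simp only
        rw [ofReal_integral_eq_lintegral_ofReal (hM.envelope.integrable_exp_of hda)
          (ae_of_all _ fun w => (Real.exp_pos _).le), mul_comm, ← lintegral_mul_const _
          (hY.mono (noiseSigma_le hA1 t) le_rfl).ennreal_ofReal]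
        exact lintegral_congr fun o => lintegral_const_mul _ hda.1.exp.ennreal_ofReal

/-- The `ω`-weighted moments of the portfolio value grow at most exponentially, at a rate that does
not depend on the weight. -/
lemma exists_lintegral_weight_le [IsProbabilityMeasure P] (hA1 : IsIIDNoise P W)
    (hA2 : IsFactorMap G) (hA3 : IsLogReturnMap F)
    (hM : IsModel (P.map (W 0)) G F ω a₁ a₂ b₁ b₂)
    (hV : 0 < V₀) (hH : IsAdmissible W H) :
    ∃ C : ℝ, 0 < C ∧ ∀ θ : ℝ, 0 ≤ θ → ∃ K : ℝ, 0 < K ∧ ∀ t,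
      ∫⁻ o, ENNReal.ofReal (portfolioValue G F W x₀ V₀ H t o ^ γ *
        Real.exp (θ * ω (factor G W x₀ t o))) ∂P ≤ ENNReal.ofReal (K * C ^ t) := by
  set D : ℝ → ℕ → ENNReal := fun θ t => ∫⁻ o, ENNReal.ofReal (portfolioValue G F W x₀ V₀ H t o ^ γ *
        Real.exp (θ * ω (factor G W x₀ t o))) ∂P with hD
  have hω := hM.ω_nonneg
  have hp : ∀ t o, 0 ≤ portfolioValue G F W x₀ V₀ H t o ^ γ := fun t o =>
    Real.rpow_nonneg (portfolioValue_pos hV t o).le γ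
  have hmono : ∀ θ θ' t, θ ≤ θ' → D θ t ≤ D θ' t := fun θ θ' t h =>
    lintegral_mono fun o => ENNReal.ofReal_le_ofReal (mul_le_mul_of_nonneg_left
      (Real.exp_le_exp.mpr (mul_le_mul_of_nonneg_right h (hω _))) (hp t o))
  have hzero : ∀ θ, D θ 0 = ENNReal.ofReal (V₀ ^ γ * Real.exp (θ * ω x₀)) := fun θ => by
    simp [hD, portfolioValue, factor]
  have hb : 0 < 1 - b₁ := sub_pos.mpr hM.b₁_lt_one
  have hb₁ := hM.b₁_pos
  have hb₂ := hM.b₂_pos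
  set mom : ℝ → ℝ := fun θ => ∫ w, Real.exp (θ * a₁ w + |γ| * a₂ w) ∂(P.map (W 0)) with hmom
  have hstep : ∀ θ t, 0 ≤ θ → D θ (t + 1) ≤ ENNReal.ofReal (mom θ) * D (θ * b₁ + |γ| * b₂) t :=
    fun θ t hθ => lintegral_weight_succ_le hA1 hA2 hA3 hM hV hH hθ t
  -- One step sends the weight `θ` to `θ b₁ + |γ| b₂`, an affine contraction. `θs` lies one above
  -- its fixed point and is therefore lowered by `1 - b₁`.
  set θs := |γ| * b₂ / (1 - b₁) + 1 with hθs
  have hθs0 : 0 < θs := by positivity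
  have hθseq : θs * b₁ + |γ| * b₂ = θs - (1 - b₁) := by rw [hθs]; field_simp; ring
  set C := max 1 (mom θs) with hC
  have hC1 : 1 ≤ C := le_max_left _ _
  have hC0 : 0 < C := by linarith
  -- Up to `θs` the rate is `C`. Each step lowers a larger weight by one layer of height `1 - b₁`
  -- and costs only a constant factor, so the rate remains `C`.
  have hkey : ∀ N : ℕ, ∀ θ, 0 ≤ θ → θ ≤ θs + N * (1 - b₁) → ∃ K : ℝ, 0 < K ∧ ∀ t,
      D θ t ≤ ENNReal.ofReal (K * C ^ t) := by
    intro N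
    induction N with
    | zero =>
      intro θ hθ hle
      refine ⟨V₀ ^ γ * Real.exp (θs * ω x₀), by positivity, fun t => ?_⟩
      refine (hmono θ θs t (by simpa using hle)).trans ?_
      induction t with
      | zero => rw [hzero]; simp
      | succ t ih =>
        calc D θs (t + 1) ≤ ENNReal.ofReal (mom θs) * D (θs * b₁ + |γ| * b₂) t :=
              hstep θs t hθs0.le
          _ ≤ ENNReal.ofReal C * ENNReal.ofReal (V₀ ^ γ * Real.exp (θs * ω x₀) * C ^ t) :=
              mul_le_mul' (ENNReal.ofReal_le_ofReal (le_max_right _ _))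
                ((hmono _ _ t (by linarith)).trans ih)
          _ = _ := by rw [← ENNReal.ofReal_mul hC0.le]; ring_nf
    | succ N ih =>
      intro θ hθ hle
      have hle' : θ * b₁ + |γ| * b₂ ≤ θs + N * (1 - b₁) := by
        push_cast at hle
        have h1 : θ * b₁ ≤ (θs + (N + 1) * (1 - b₁)) * b₁ := mul_le_mul_of_nonneg_right hle hb₁.le
        have h2 : (N + 1 : ℝ) * (1 - b₁) * b₁ ≤ (N + 1) * (1 - b₁) :=
          mul_le_of_le_one_right (by positivity) (by linarith)
        linarith
      obtain ⟨K, hK, hKt⟩ := ih _ (by positivity) hle'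
      -- The second entry covers time zero; at later times `C ≥ 1` absorbs the shift from `t` to `t
      -- + 1`.
      refine ⟨max (|mom θ| * K) (V₀ ^ γ * Real.exp (θ * ω x₀)),
        lt_max_of_lt_right (by positivity), fun t => ?_⟩
      cases t with
      | zero => rw [hzero]; exact ENNReal.ofReal_le_ofReal (by simp)
      | succ t =>
        calc D θ (t + 1) ≤ ENNReal.ofReal (mom θ) * D (θ * b₁ + |γ| * b₂) t := hstep θ t hθ
          _ ≤ ENNReal.ofReal |mom θ| * ENNReal.ofReal (K * C ^ t) :=
              mul_le_mul' (ENNReal.ofReal_le_ofReal (le_abs_self _)) (hKt t)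
          _ = ENNReal.ofReal (|mom θ| * K * C ^ t) := by
              rw [← ENNReal.ofReal_mul (abs_nonneg _)]; ring_nf
          _ ≤ _ := ENNReal.ofReal_le_ofReal (mul_le_mul (le_max_left _ _)
              (pow_le_pow_right₀ hC1 t.le_succ) (by positivity)
              ((by positivity : 0 ≤ |mom θ| * K).trans (le_max_left _ _)))
  refine ⟨C, hC0, fun θ hθ => ?_⟩
  obtain ⟨N, hN⟩ := exists_nat_ge ((θ - θs) / (1 - b₁))
  rw [div_le_iff₀ hb] at hN
  exact hkey N θ hθ (by linarith)

end Strategies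

/-! ### Growth rates from moment bounds. -/

section Limits

/-- Dividing by `γ t` bounds the normalized logarithm asymptotically by `(lam - (1 - s) c / γ) / s`,
which tends to `lam` as `s → 1`. The constant `κ` may depend on `s`, but `c` may not. -/
lemma liminf_growth_le {γ lam j c : ℝ} (hγ : γ < 0) {l : ℕ → ℝ}
    (h : ∀ s : ℝ, 0 < s → s < 1 → ∃ κ : ℝ, ∀ t : ℕ,
      j + γ * lam * t ≤ s * l t + (1 - s) * (κ + c * t)) :
    liminf (fun t : ℕ => ((1 / (t : ℝ) * (1 / γ * l t) : ℝ) : EReal)) atTop ≤ (lam : EReal) := by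
  refine EReal.le_of_forall_lt_iff_le.mp fun z hz => ?_
  rw [EReal.coe_lt_coe_iff] at hz
  have hs : Tendsto (fun s : ℝ => (lam - (1 - s) * c / γ) / s) (nhdsWithin 1 (Set.Iio 1))
      (nhds lam) := by
    have : ContinuousAt (fun s : ℝ => (lam - (1 - s) * c / γ) / s) 1 := by
      refine ContinuousAt.div ?_ continuousAt_id one_ne_zero
      fun_prop
    have h1 : Tendsto _ _ _ := this.continuousWithinAt (s := Set.Iio 1)
    simpa using h1
  have h0 : ∀ᶠ s : ℝ in nhdsWithin 1 (Set.Iio 1), 0 < s :=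
    nhdsWithin_le_nhds (lt_mem_nhds zero_lt_one)
  obtain ⟨s, hsz, hs0, hs1⟩ := ((hs.eventually_lt_const hz).and
    (h0.and self_mem_nhdsWithin)).exists
  obtain ⟨κ, hκ⟩ := h s hs0 hs1
  have hlim : Tendsto (fun t : ℕ => (lam - (1 - s) * c / γ + (j - (1 - s) * κ) / γ * (1 / (t : ℝ))) / s)
      atTop (nhds ((lam - (1 - s) * c / γ) / s)) := by
    have := ((tendsto_one_div_atTop_nhds_zero_nat (𝕜 := ℝ)).const_mul
      ((j - (1 - s) * κ) / γ)).const_add (lam - (1 - s) * c / γ)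
    simpa using this.div_const s
  refine liminf_le_of_frequently_le' (Eventually.frequently ?_)
  filter_upwards [hlim.eventually_lt_const hsz, eventually_gt_atTop 0] with t ht ht0
  rw [EReal.coe_le_coe_iff]
  refine le_trans ?_ ht.le
  have ht' : (0 : ℝ) < t := Nat.cast_pos.mpr ht0
  rw [le_div_iff₀ hs0]
  have hk := div_le_div_of_nonpos_of_le hγ.le (hκ t)
  have h2 := div_le_div_of_nonneg_right hk ht'.le
  have e1 : (j + γ * lam * t) / γ / t = lam + j / γ * (1 / t) := by
    field_simp [hγ.ne]; ring
  have e2 : (s * l t + (1 - s) * (κ + c * t)) / γ / t =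
      1 / t * (1 / γ * l t) * s + (1 - s) * c / γ + (1 - s) * κ / γ * (1 / t) := by
    field_simp [hγ.ne]
    ring
  rw [e1, e2] at h2
  have e3 : (j - (1 - s) * κ) / γ * (1 / (t : ℝ)) =
    j / γ * (1 / t) - (1 - s) * κ / γ * (1 / t) := by ring
  rw [e3]
  linarith

lemma liminf_growth_eq {γ lam j κ : ℝ} (hγ : γ < 0) {l : ℕ → ℝ}
    (h : ∀ t : ℕ, |l t - (j + γ * lam * t)| ≤ κ) :
    liminf (fun t : ℕ => ((1 / (t : ℝ) * (1 / γ * l t) : ℝ) : EReal)) atTop = (lam : EReal) := by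
  refine Tendsto.liminf_eq ((continuous_coe_real_ereal.tendsto lam).comp ?_)
  rw [tendsto_iff_dist_tendsto_zero]
  have hlim : Tendsto (fun t : ℕ => (κ + |j|) / |γ| * (1 / (t : ℝ))) atTop (nhds 0) := by
    simpa using (tendsto_one_div_atTop_nhds_zero_nat (𝕜 := ℝ)).const_mul ((κ + |j|) / |γ|)
  refine squeeze_zero' (Eventually.of_forall fun t => dist_nonneg) ?_ hlim
  filter_upwards [eventually_gt_atTop 0] with t ht0
  have ht' : (0 : ℝ) < t := Nat.cast_pos.mpr ht0
  have e : 1 / (t : ℝ) * (1 / γ * l t) - lam = (l t - γ * lam * t) / γ * (1 / t) := by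
    field_simp [hγ.ne]
  rw [Real.dist_eq, e, abs_mul, abs_div, abs_of_pos (by positivity : 0 < 1 / (t : ℝ))]
  refine mul_le_mul_of_nonneg_right (div_le_div_of_nonneg_right ?_ (abs_nonneg γ)) (by positivity)
  have := abs_add_le (l t - (j + γ * lam * t)) j
  rw [show l t - (j + γ * lam * t) + j = l t - γ * lam * t by ring] at this
  linarith [h t]

end Limits

/-! ### Verification: moments of strategies against the Bellman constant. -/

section Verification

variable {Ω : Type*} [MeasurableSpace Ω] {P : Measure Ω} {k m n : ℕ}
  {U : Set (Vec m)} {W : ℕ → Ω → Vec n} {G : Vec k → Vec n → Vec k} {F : Vec k → U → Vec n → ℝ}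
  {ω : Vec k → ℝ} {a₁ a₂ : Vec n → ℝ} {b₁ b₂ γ lam : ℝ} {H : ℕ → Ω → U} {x₀ : Vec k} {V₀ : ℝ}
  {v : Vec k → ℝ}

lemma riskSensitiveCriterion_eq_liminf {V : ℕ → Ω → ℝ} {e : ℕ → ℝ}
    (he : ∀ t, 0 < e t ∧ ∫⁻ o, ENNReal.ofReal (V t o ^ γ) ∂P = ENNReal.ofReal (e t)) :
    riskSensitiveCriterion P γ V =
      liminf (fun t : ℕ => ((1 / (t : ℝ) * (1 / γ * Real.log (e t)) : ℝ) : EReal)) atTop := by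
  rw [riskSensitiveCriterion]
  congr 1
  ext t
  rw [(he t).2, ENNReal.log_ofReal_of_pos (he t).1, EReal.coe_mul, EReal.coe_mul]

/-- The recursion for `ω` is an affine contraction with bounded input, so the weight stays below a
deterministic level. -/
lemma exists_factor_weight_le (hM : IsModel (P.map (W 0)) G F ω a₁ a₂ b₁ b₂)
    (ha : BddAbove (Set.range a₁)) (x₀ : Vec k) :
    ∃ B : ℝ, 0 ≤ B ∧ ∀ t o, ω (factor G W x₀ t o) ≤ B := by
  obtain ⟨a, ha⟩ := ha
  have ha' : ∀ w, a₁ w ≤ a := fun w => ha ⟨w, rfl⟩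
  have hb : 0 < 1 - b₁ := sub_pos.mpr hM.b₁_lt_one
  have hb₁ := hM.b₁_pos
  have hω := hM.ω_nonneg x₀
  have hpos : 0 ≤ |a| / (1 - b₁) := by positivity
  refine ⟨ω x₀ + |a| / (1 - b₁), by positivity, fun t o => ?_⟩
  induction t with
  | zero => simpa [factor] using hpos
  | succ t ih =>
    have h1 := hM.growth_G (factor G W x₀ t o) (W t o)
    have h2 := mul_le_mul_of_nonneg_left ih hb₁.le
    have h3 : |a| + b₁ * (|a| / (1 - b₁)) = |a| / (1 - b₁) := by field_simp; ring
    have h4 : b₁ * ω x₀ ≤ ω x₀ := mul_le_of_le_one_left hω hM.b₁_lt_one.le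
    show ω (G (factor G W x₀ t o) (W t o)) ≤ _
    linarith [ha' (W t o), le_abs_self a]

variable [IsProbabilityMeasure P]

/-- The power moments of the portfolio value are finite and positive. -/
lemma exists_lintegral_value_eq (hA1 : IsIIDNoise P W)
    (hA2 : IsFactorMap G) (hA3 : IsLogReturnMap F)
    (hM : IsModel (P.map (W 0)) G F ω a₁ a₂ b₁ b₂)
    (hV : 0 < V₀) (hH : IsAdmissible W H) :
    ∃ e : ℕ → ℝ, ∀ t, 0 < e t ∧
      ∫⁻ o, ENNReal.ofReal (portfolioValue G F W x₀ V₀ H t o ^ γ) ∂P = ENNReal.ofReal (e t) := by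
  obtain ⟨C, hC, hCt⟩ := exists_lintegral_weight_le (γ := γ) (x₀ := x₀) hA1 hA2 hA3 hM hV hH
  obtain ⟨K, hK, hKt⟩ := hCt 0 le_rfl
  simp only [zero_mul, Real.exp_zero, mul_one] at hKt
  refine ⟨fun t => (∫⁻ o, ENNReal.ofReal (portfolioValue G F W x₀ V₀ H t o ^ γ) ∂P).toReal,
    fun t => ?_⟩
  have hfin := ((hKt t).trans_lt ENNReal.ofReal_lt_top).ne
  refine ⟨ENNReal.toReal_pos ?_ hfin, (ENNReal.ofReal_toReal hfin).symm⟩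
  have hmeas : Measurable fun o => ENNReal.ofReal (portfolioValue G F W x₀ V₀ H t o ^ γ) :=
    (((measurable_portfolioValue hA2 hA3 hH x₀ V₀ t).mono (noiseSigma_le hA1 t)
      le_rfl).pow_const γ).ennreal_ofReal
  rw [Ne, lintegral_eq_zero_iff hmeas]
  intro h
  obtain ⟨o, ho⟩ := h.exists
  simp only [Pi.zero_apply, ENNReal.ofReal_eq_zero] at ho
  exact absurd (Real.rpow_pos_of_pos (portfolioValue_pos hV t o) γ) (not_lt.mpr ho)

/-- Lower bound for the weighted power moments of every admissible strategy. -/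
lemma le_lintegral_value (hA1 : IsIIDNoise P W) (hA2 : IsFactorMap G) (hA3 : IsLogReturnMap F)
    (hM : IsModel (P.map (W 0)) G F ω a₁ a₂ b₁ b₂) (hγ : γ < 0) (hV : 0 < V₀)
    (hH : IsAdmissible W H) (hv : GrowsLinearly ω v)
    (hu : ∀ x h, util (P.map (W 0)) G F γ v x h ≤ v x + lam) (t : ℕ) :
    ENNReal.ofReal (V₀ ^ γ * Real.exp (γ * v x₀) * Real.exp (γ * lam * t)) ≤
      ∫⁻ o, ENNReal.ofReal (portfolioValue G F W x₀ V₀ H t o ^ γ *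
        Real.exp (γ * v (factor G W x₀ t o))) ∂P := by
  induction t with
  | zero => simp [portfolioValue, factor]
  | succ t ih =>
    rw [lintegral_value_succ hA1 hA2 hA3 hM hγ hV hH hv]
    calc _ = ENNReal.ofReal (Real.exp (γ * lam)) *
          ENNReal.ofReal (V₀ ^ γ * Real.exp (γ * v x₀) * Real.exp (γ * lam * t)) := by
          rw [← ENNReal.ofReal_mul (Real.exp_pos _).le]
          push_cast
          rw [mul_add, mul_one, Real.exp_add]
          ring_nf
      _ ≤ _ := mul_le_mul' le_rfl ih
      _ = ∫⁻ o, ENNReal.ofReal (Real.exp (γ * lam)) *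
          ENNReal.ofReal (portfolioValue G F W x₀ V₀ H t o ^ γ *
            Real.exp (γ * v (factor G W x₀ t o))) ∂P :=
          (lintegral_const_mul' _ _ ENNReal.ofReal_ne_top).symm
      _ ≤ _ := lintegral_mono fun o => by
          rw [← ENNReal.ofReal_mul (Real.exp_pos _).le]
          refine ENNReal.ofReal_le_ofReal ?_
          rw [mul_left_comm, ← Real.exp_add]
          refine mul_le_mul_of_nonneg_left (Real.exp_le_exp.mpr ?_)
            (Real.rpow_nonneg (portfolioValue_pos hV t o).le γ)
          -- Multiplication by `γ < 0` turns the upper bound on the utility into a lower bound on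
          -- the moment.
          have := mul_le_mul_of_nonpos_left (hu (factor G W x₀ t o) (H t o)) hγ.le
          linarith

/-- Equality for strategies attaining the Bellman supremum. -/
lemma lintegral_value_eq (hA1 : IsIIDNoise P W) (hA2 : IsFactorMap G) (hA3 : IsLogReturnMap F)
    (hM : IsModel (P.map (W 0)) G F ω a₁ a₂ b₁ b₂) (hγ : γ < 0) (hV : 0 < V₀)
    (hH : IsAdmissible W H) (hv : GrowsLinearly ω v)
    (hu : ∀ t o, util (P.map (W 0)) G F γ v (factor G W x₀ t o) (H t o) =
      v (factor G W x₀ t o) + lam) (t : ℕ) :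
    ∫⁻ o, ENNReal.ofReal (portfolioValue G F W x₀ V₀ H t o ^ γ *
        Real.exp (γ * v (factor G W x₀ t o))) ∂P =
      ENNReal.ofReal (V₀ ^ γ * Real.exp (γ * v x₀) * Real.exp (γ * lam * t)) := by
  induction t with
  | zero => simp [portfolioValue, factor]
  | succ t ih =>
    rw [lintegral_value_succ hA1 hA2 hA3 hM hγ hV hH hv]
    calc _ = ∫⁻ o, ENNReal.ofReal (Real.exp (γ * lam)) *
          ENNReal.ofReal (portfolioValue G F W x₀ V₀ H t o ^ γ *
            Real.exp (γ * v (factor G W x₀ t o))) ∂P := lintegral_congr fun o => by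
          rw [← ENNReal.ofReal_mul (Real.exp_pos _).le, mul_left_comm, ← Real.exp_add, hu, mul_add,
            add_comm (γ * lam)]
      _ = ENNReal.ofReal (Real.exp (γ * lam)) *
          ENNReal.ofReal (V₀ ^ γ * Real.exp (γ * v x₀) * Real.exp (γ * lam * t)) := by
          rw [lintegral_const_mul' _ _ ENNReal.ofReal_ne_top, ih]
      _ = _ := by
          rw [← ENNReal.ofReal_mul (Real.exp_pos _).le]
          push_cast
          rw [mul_add, mul_one, Real.exp_add]
          ring_nf

/-- The constant of the Bellman equation dominates the criterion of every admissible strategy. -/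
theorem riskSensitiveCriterion_le (hA1 : IsIIDNoise P W) (hA2 : IsFactorMap G)
    (hA3 : IsLogReturnMap F) (hM : IsModel (P.map (W 0)) G F ω a₁ a₂ b₁ b₂) (hγ : γ < 0)
    (hV : 0 < V₀) (hH : IsAdmissible W H) (hv : GrowsLinearly ω v)
    (hu : ∀ x h, util (P.map (W 0)) G F γ v x h ≤ v x + lam) :
    riskSensitiveCriterion P γ (portfolioValue G F W x₀ V₀ H) ≤ (lam : EReal) := by
  obtain ⟨e, he⟩ := exists_lintegral_value_eq (γ := γ) (x₀ := x₀) hA1 hA2 hA3 hM hV hH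
  rw [riskSensitiveCriterion_eq_liminf he]
  obtain ⟨C, hC, hCt⟩ := exists_lintegral_weight_le (γ := γ) (x₀ := x₀) hA1 hA2 hA3 hM hV hH
  obtain ⟨-, B, hB⟩ := id hv
  have hj : 0 < V₀ ^ γ * Real.exp (γ * v x₀) := by positivity
  refine liminf_growth_le (j := Real.log (V₀ ^ γ * Real.exp (γ * v x₀))) (c := Real.log C) hγ
    fun s hs0 hs1 => ?_
  have hs : 0 < 1 - s := sub_pos.mpr hs1
  -- Chosen so that `γ v / (1 - s) ≤ θ (1 + ω)`.
  set θ := |γ| * |B| / (1 - s) with hθ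
  obtain ⟨K, hK, hKt⟩ := hCt θ (by positivity)
  refine ⟨Real.log (Real.exp θ * K), fun t => ?_⟩
  obtain ⟨het, heq⟩ := he t
  set V := portfolioValue G F W x₀ V₀ H t with hVd
  set Xt := factor G W x₀ t with hXt
  have hVpos : ∀ o, 0 < V o ^ γ := fun o => Real.rpow_pos_of_pos (portfolioValue_pos hV t o) γ
  have hVm : Measurable V :=
    (measurable_portfolioValue hA2 hA3 hH x₀ V₀ t).mono (noiseSigma_le hA1 t) le_rfl
  have hXm : Measurable Xt :=
    (measurable_factor hA2 W x₀ t).mono (noiseSigma_le hA1 t) le_rfl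
  have hf : Measurable fun o => ENNReal.ofReal (V o ^ γ) := (hVm.pow_const γ).ennreal_ofReal
  have hg : Measurable fun o =>
      ENNReal.ofReal (V o ^ γ * Real.exp (γ * v (Xt o) / (1 - s))) :=
    ((hVm.pow_const γ).mul
      (((hv.1.measurable.comp hXm).const_mul γ).div_const (1 - s)).exp).ennreal_ofReal
  have hH1 := le_lintegral_value (x₀ := x₀) hA1 hA2 hA3 hM hγ hV hH hv hu t
  -- Hölder's inequality with weights `s` and `1 - s`. The power of `V` is shared between both
  -- factors, and the second one carries all of `exp (γ v)`.
  have hH2 : ∫⁻ o, ENNReal.ofReal (V o ^ γ * Real.exp (γ * v (Xt o))) ∂P ≤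
      ENNReal.ofReal (e t) ^ s * ENNReal.ofReal (Real.exp θ * K * C ^ t) ^ (1 - s) := by
    calc _ = ∫⁻ o, ENNReal.ofReal (V o ^ γ) ^ s *
          ENNReal.ofReal (V o ^ γ * Real.exp (γ * v (Xt o) / (1 - s))) ^ (1 - s) ∂P := by
          refine lintegral_congr fun o => ?_
          have hp := hVpos o
          rw [ENNReal.ofReal_rpow_of_pos hp, ENNReal.ofReal_rpow_of_pos (by positivity),
            ← ENNReal.ofReal_mul (by positivity), Real.mul_rpow hp.le (Real.exp_pos _).le,
            ← mul_assoc, ← Real.rpow_add hp, ← Real.exp_mul, div_mul_cancel₀ _ hs.ne',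
            add_sub_cancel, Real.rpow_one]
      _ ≤ _ := ENNReal.lintegral_mul_norm_pow_le hf.aemeasurable hg.aemeasurable hs0.le hs.le
          (by ring)
      _ ≤ _ := by
          refine mul_le_mul' (by rw [heq]) (ENNReal.rpow_le_rpow ?_ hs.le)
          calc _ ≤ ∫⁻ o, ENNReal.ofReal (Real.exp θ) *
                ENNReal.ofReal (V o ^ γ * Real.exp (θ * ω (Xt o))) ∂P := by
                refine lintegral_mono fun o => ?_
                rw [← ENNReal.ofReal_mul (Real.exp_pos _).le]
                refine ENNReal.ofReal_le_ofReal ?_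
                rw [mul_left_comm, ← Real.exp_add]
                refine mul_le_mul_of_nonneg_left (Real.exp_le_exp.mpr ?_) (hVpos o).le
                have h1 : γ * v (Xt o) ≤ |γ| * |B| * (1 + ω (Xt o)) := by
                  refine (le_abs_self _).trans ?_
                  rw [abs_mul, mul_assoc]
                  refine mul_le_mul_of_nonneg_left ((hB _).trans ?_) (abs_nonneg γ)
                  exact mul_le_mul_of_nonneg_right (le_abs_self B)
                    (by linarith [hM.ω_nonneg (Xt o)])
                rw [div_le_iff₀ hs, hθ]
                refine h1.trans (le_of_eq ?_)
                field_simp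
            _ = ENNReal.ofReal (Real.exp θ) *
                ∫⁻ o, ENNReal.ofReal (V o ^ γ * Real.exp (θ * ω (Xt o))) ∂P :=
                lintegral_const_mul' _ _ ENNReal.ofReal_ne_top
            _ ≤ ENNReal.ofReal (Real.exp θ) * ENNReal.ofReal (K * C ^ t) :=
                mul_le_mul' le_rfl (hKt t)
            _ = _ := by rw [← ENNReal.ofReal_mul (Real.exp_pos _).le, mul_assoc]
  have hKC : 0 < Real.exp θ * K * C ^ t := by positivity
  have h3 := hH1.trans hH2
  rw [ENNReal.ofReal_rpow_of_pos het, ENNReal.ofReal_rpow_of_pos hKC,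
    ← ENNReal.ofReal_mul (by positivity), ENNReal.ofReal_le_ofReal_iff (by positivity)] at h3
  have h4 := Real.log_le_log (by positivity) h3
  rw [Real.log_mul hj.ne' (Real.exp_pos _).ne', Real.log_exp,
    Real.log_mul (Real.rpow_pos_of_pos het s).ne' (Real.rpow_pos_of_pos hKC _).ne',
    Real.log_rpow het, Real.log_rpow hKC,
    Real.log_mul (mul_pos (Real.exp_pos θ) hK).ne' (pow_pos hC t).ne', Real.log_pow] at h4
  linarith

/-- The criterion of a strategy attaining the Bellman supremum, for bounded noise weight. -/
theorem riskSensitiveCriterion_eq (hA1 : IsIIDNoise P W) (hA2 : IsFactorMap G)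
    (hA3 : IsLogReturnMap F) (hM : IsModel (P.map (W 0)) G F ω a₁ a₂ b₁ b₂)
    (ha : BddAbove (Set.range a₁)) (hγ : γ < 0)
    (hV : 0 < V₀) (hH : IsAdmissible W H) (hv : GrowsLinearly ω v)
    (hu : ∀ t o, util (P.map (W 0)) G F γ v (factor G W x₀ t o) (H t o) =
      v (factor G W x₀ t o) + lam) :
    riskSensitiveCriterion P γ (portfolioValue G F W x₀ V₀ H) = (lam : EReal) := by
  obtain ⟨e, he⟩ := exists_lintegral_value_eq (γ := γ) (x₀ := x₀) hA1 hA2 hA3 hM hV hH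
  rw [riskSensitiveCriterion_eq_liminf he]
  obtain ⟨B, hB0, hB⟩ := exists_factor_weight_le hM ha x₀
  obtain ⟨-, C, hC⟩ := id hv
  have hj : 0 < V₀ ^ γ * Real.exp (γ * v x₀) := by positivity
  set κ := |γ| * (|C| * (1 + B)) with hκ
  have hvκ : ∀ t o, |γ * v (factor G W x₀ t o)| ≤ κ := fun t o => by
    rw [abs_mul]
    refine mul_le_mul_of_nonneg_left ((hC _).trans ?_) (abs_nonneg γ)
    have h0 := hM.ω_nonneg (factor G W x₀ t o)
    exact mul_le_mul (le_abs_self C) (by linarith [hB t o]) (by linarith) (abs_nonneg C)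
  refine liminf_growth_eq (j := Real.log (V₀ ^ γ * Real.exp (γ * v x₀))) (κ := κ) hγ fun t => ?_
  obtain ⟨het, heq⟩ := he t
  have hJ := lintegral_value_eq (x₀ := x₀) hA1 hA2 hA3 hM hγ hV hH hv hu t
  have hp : ∀ o, 0 ≤ portfolioValue G F W x₀ V₀ H t o ^ γ := fun o =>
    Real.rpow_nonneg (portfolioValue_pos hV t o).le γ
  -- Since `|γ v(X_t)| ≤ κ`, the weighted and unweighted moments differ by a factor between `exp
  -- (-κ)` and `exp κ`.
  have hup : V₀ ^ γ * Real.exp (γ * v x₀) * Real.exp (γ * lam * t) ≤ Real.exp κ * e t := by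
    rw [← ENNReal.ofReal_le_ofReal_iff (by positivity), ← hJ,
      ENNReal.ofReal_mul (Real.exp_pos _).le, ← heq,
      ← lintegral_const_mul' _ _ ENNReal.ofReal_ne_top]
    refine lintegral_mono fun o => ?_
    rw [← ENNReal.ofReal_mul (Real.exp_pos _).le, mul_comm (Real.exp κ)]
    exact ENNReal.ofReal_le_ofReal (mul_le_mul_of_nonneg_left
      (Real.exp_le_exp.mpr (abs_le.mp (hvκ t o)).2) (hp o))
  have hlo : Real.exp (-κ) * e t ≤
      V₀ ^ γ * Real.exp (γ * v x₀) * Real.exp (γ * lam * t) := by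
    rw [← ENNReal.ofReal_le_ofReal_iff (by positivity), ← hJ,
      ENNReal.ofReal_mul (Real.exp_pos _).le, ← heq,
      ← lintegral_const_mul' _ _ ENNReal.ofReal_ne_top]
    refine lintegral_mono fun o => ?_
    rw [← ENNReal.ofReal_mul (Real.exp_pos _).le, mul_comm (Real.exp (-κ))]
    exact ENNReal.ofReal_le_ofReal (mul_le_mul_of_nonneg_left
      (Real.exp_le_exp.mpr (abs_le.mp (hvκ t o)).1) (hp o))
  have h1 := Real.log_le_log (by positivity) hup
  have h2 := Real.log_le_log (by positivity) hlo
  rw [Real.log_mul hj.ne' (Real.exp_pos _).ne', Real.log_exp,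
    Real.log_mul (Real.exp_pos _).ne' het.ne', Real.log_exp] at h1 h2
  rw [abs_le]
  constructor <;> linarith

end Verification

end RSC

/-! ### Assembly of the theorem. -/

theorem mainTheorem3 {Ω : Type*} [MeasurableSpace Ω] (P : Measure Ω) [IsProbabilityMeasure P]
    (k m : ℕ) (U : Set (RSC.Vec m)) (hU : IsCompact U) (hU' : U.Nonempty)
    (W : ℕ → Ω → RSC.Vec (k + m)) (hA1 : RSC.IsIIDNoise P W)
    (G : RSC.Vec k → RSC.Vec (k + m) → RSC.Vec k) (hA2 : RSC.IsFactorMap G)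
    (F : RSC.Vec k → U → RSC.Vec (k + m) → ℝ) (hA3 : RSC.IsLogReturnMap F)
    (ω : RSC.Vec k → ℝ) (a₁ a₂ : RSC.Vec (k + m) → ℝ) (b₁ b₂ : ℝ)
    (hA4 : RSC.HasWeightedGrowth P W G F ω a₁ a₂ b₁ b₂)
    (hA5 : RSC.HasLocalMinorization P W G ω) :
    ∃ γ₀ : ℝ, γ₀ < 0 ∧ ∀ γ : ℝ, γ₀ < γ → γ < 0 →
      ∃ (v : RSC.Vec k → ℝ) (lam : ℝ),
        RSC.IsBellmanSolution P G F W ω γ v lam ∧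
        (∀ (v' : RSC.Vec k → ℝ) (lam' : ℝ), RSC.IsBellmanSolution P G F W ω γ v' lam' →
          lam' = lam ∧ ∃ c : ℝ, ∀ x, v' x = v x + c) ∧
        (∀ (x₀ : RSC.Vec k) (V₀ : ℝ), 0 < V₀ →
          RSC.optimalValue P G F W γ x₀ V₀ ≤ (lam : EReal)) ∧
        (BddAbove (Set.range a₁) →
          (∀ (x₀ : RSC.Vec k) (V₀ : ℝ), 0 < V₀ →
            RSC.optimalValue P G F W γ x₀ V₀ = (lam : EReal)) ∧
          (∃ η : RSC.Vec k → U, RSC.IsBellmanSelector P G F W γ v η) ∧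
          ∀ η : RSC.Vec k → U, RSC.IsBellmanSelector P G F W γ v η →
            ∀ (x₀ : RSC.Vec k) (V₀ : ℝ), 0 < V₀ →
              RSC.IsAdmissible W (fun t o => η (RSC.factor G W x₀ t o)) ∧
              RSC.riskSensitiveCriterion P γ (RSC.portfolioValue G F W x₀ V₀
                (fun t o => η (RSC.factor G W x₀ t o))) = (lam : EReal)) := by
  have : CompactSpace U := isCompact_iff_compactSpace.mp hU
  have : Nonempty U := hU'.to_subtype
  have hW := hA1.measurable 0
  have : IsProbabilityMeasure (P.map (W 0)) := Measure.isProbabilityMeasure_map hW.aemeasurable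
  have hM := RSC.isModel_of hA1 hA2 hA3 hA4
  have hN := RSC.isLocallyMinorized_of hA1 hA2 hA5
  obtain ⟨γ₀, hγ₀, hsol⟩ := hM.exists_bellman_solution hN
  refine ⟨γ₀, hγ₀, fun γ hγ1 hγ => ?_⟩
  obtain ⟨v, lam, hv, hvl⟩ := hsol γ hγ1 hγ
  have hu : ∀ x h, RSC.util (P.map (W 0)) G F γ v x h ≤ v x + lam := fun x h => by
    rw [hvl]; exact hM.util_le_bellman hv x h
  have hle : ∀ (x₀ : RSC.Vec k) (V₀ : ℝ), 0 < V₀ →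
      RSC.optimalValue P G F W γ x₀ V₀ ≤ (lam : EReal) := fun x₀ V₀ hV =>
    iSup_le fun H => RSC.riskSensitiveCriterion_le hA1 hA2 hA3 hM hγ hV H.2 hv hu
  refine ⟨v, lam, (RSC.isBellmanSolution_iff hW hM hγ).mpr ⟨hv, hvl⟩, fun v' lam' h' => ?_, hle,
    fun ha => ?_⟩
  · obtain ⟨hv', hvl'⟩ := (RSC.isBellmanSolution_iff hW hM hγ).mp h'
    exact hM.bellman_solution_unique hN hγ hv hv' hvl hvl'
  have hopt : ∀ η : RSC.Vec k → U, RSC.IsBellmanSelector P G F W γ v η →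
      ∀ (x₀ : RSC.Vec k) (V₀ : ℝ), 0 < V₀ →
        RSC.IsAdmissible W (fun t o => η (RSC.factor G W x₀ t o)) ∧
        RSC.riskSensitiveCriterion P γ (RSC.portfolioValue G F W x₀ V₀
          (fun t o => η (RSC.factor G W x₀ t o))) = (lam : EReal) := by
    intro η hη x₀ V₀ hV
    have hadm := RSC.isAdmissible_feedback (W := W) hA2 hη.1 x₀
    refine ⟨hadm, RSC.riskSensitiveCriterion_eq hA1 hA2 hA3 hM ha hγ hV hadm hv fun t o => ?_⟩
    have := hη.2 (RSC.factor G W x₀ t o)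
    rw [RSC.iSup_bellmanUtility hW hM hγ hv, RSC.bellmanUtility_eq hW hM hγ hv, ← hvl,
      EReal.coe_eq_coe_iff] at this
    exact this
  obtain ⟨η, hη⟩ : ∃ η : RSC.Vec k → U, RSC.IsBellmanSelector P G F W γ v η := by
    -- The `m` coordinates separate the points of `U`; the value `0` beyond index `m` only completes
    -- the sequence.
    obtain ⟨η, hηm, hη⟩ := RSC.exists_measurable_argmax (n := m)
      (q := fun i (a : U) => if h : i < m then (a : RSC.Vec m) ⟨i, h⟩ else 0)
      (fun i => by
        by_cases h : i < m
        · simp only [h, dite_true]; fun_prop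
        · simp only [h, dite_false]; fun_prop)
      (fun a b hab => by
        ext i
        simpa using hab i i.2)
      (hM.continuous_util (γ := γ) hv)
    refine ⟨η, hηm, fun x => le_antisymm (le_iSup _ (η x)) (iSup_le fun h => ?_)⟩
    rw [RSC.bellmanUtility_eq hW hM hγ hv, RSC.bellmanUtility_eq hW hM hγ hv]
    exact EReal.coe_le_coe (hη x h)
  refine ⟨fun x₀ V₀ hV => le_antisymm (hle x₀ V₀ hV) ?_, ⟨η, hη⟩, hopt⟩
  obtain ⟨hadm, hval⟩ := hopt η hη x₀ V₀ hV
  rw [← hval]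
  exact le_iSup (fun H : {H : ℕ → Ω → U // RSC.IsAdmissible W H} =>
    RSC.riskSensitiveCriterion P γ (RSC.portfolioValue G F W x₀ V₀ H.1)) ⟨_, hadm⟩
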